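/- Let $\mathbb{K}$ be an algebraically closed field (of any characteristic), let $N$ be a lattice (free abelian group of finite rank) with dual lattice $M=\mathrm{Hom}(N,\mathbb{Z})$, and let $\sigma\subset N_{\mathbb{R}}$ be a strictly convex cone, generated by finitely many elements of $N$, with non-empty interior $\sigma^\circ$. Put $\Gamma=\sigma^\vee\cap M$ and let $\mathbb{K}[[\Gamma]]$ be the ring of formal power series $f=\sum_{m\in\Gamma}f_m\chi^m$, which is the local ring of the formal germ $(\mathcal{X}_\sigma,0)$ at its closed orbit of the affine toric variety $\mathcal{X}_\sigma$. An interior subtoric germ $Y\hookrightarrow(\mathcal{X}_\sigma,0)$ is a closed formal subgerm, with defining ideal $I_Y\subseteq\mathbb{K}[[\Gamma]]$, which is reduced (that is, $I_Y$ is radical) and none of whose irreducible components is contained in the toric boundary of $\mathcal{X}_\sigma$ (that is, no minimal prime of $I_Y$ contains a monomial $\chi^m$, $m\in\Gamma$). For $w\in\sigma^\circ$ and $f\in\mathbb{K}[[\Gamma]]$, the $w$-initial form $\mathrm{in}_w f$ is the sum of the terms $f_m\chi^m$ of $f$ whose exponents $m$ lie in the support of $f$ and minimize $w\cdot m$ on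 this support (and $\mathrm{in}_w 0=0$). For an ideal $I$, let $\mathrm{in}_w I$ be the ideal of $\mathbb{K}[[\Gamma]]$ generated by all $\mathrm{in}_w f$, $f\in I$. The local tropicalization $\mathrm{Trop}_{\mathrm{loc}}Y\subseteq\sigma$ is the closure in $N_{\mathbb{R}}$ of the union of the rays $\mathbb{R}_{\ge 0}w$, where $w$ runs through the vectors of $\sigma^\circ$ such that $\mathrm{in}_w I_Y$ contains no monomial $\chi^m$, $m\in\Gamma$. An interior principal effective divisor is an interior subtoric germ $D$ whose defining ideal is generated by a single non zero divisor, $I_D=(f)$; it contains $Y$ if $I_D\subseteq I_Y$. Proposition. For every interior subtoric germ $Y\hookrightarrow(\mathcal{X}_\sigma,0)$, the local tropicalization of $Y$ is the intersection of the local tropicalizations of all the interior principal effective divisors containing it: $$\mathrm{Trop}_{\mathrm{loc}}\,Y=\bigcap_{D\supseteq Y}\mathrm{Trop}_{\mathrm{loc}}\,D ,$$ where the intersection is taken among subsets of $\sigma$ (so it equals $\sigma$ if there is no such divisor $D$). -/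

import Mathlib

noncomputable section

namespace LocTrop

variable {V : Type*} [NormedAddCommGroup V] [NormedSpace ℝ V]

/-- The lattice `M` of exponents dual to a weight lattice `N` in the real vector space `V = N_ℝ`:
the linear forms on `V` which take integral values on `N`. -/
def dualLattice (N : Submodule ℤ V) : AddSubgroup (Module.Dual ℝ V) where
  carrier := {m | ∀ x ∈ N, ∃ k : ℤ, m x = k}
  zero_mem' := fun _ _ => ⟨0, by simp⟩
  add_mem' := fun {a b} ha hb x hx => by
    obtain ⟨k, hk⟩ := ha x hx
    obtain ⟨l, hl⟩ := hb x hx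
    exact ⟨k + l, by simp [hk, hl]⟩
  neg_mem' := fun {a} ha x hx => by
    obtain ⟨k, hk⟩ := ha x hx
    exact ⟨-k, by simp [hk]⟩

/-- A strictly convex cone `σ` in `V = N_ℝ`, rational and polyhedral with respect to the lattice
`N`, with non-empty interior. -/
structure WeightCone (N : Submodule ℤ V) where
  /-- the underlying convex cone (containing the origin) -/
  cone : PointedCone ℝ V
  rational_polyhedral : ∃ S : Finset V, (S : Set V) ⊆ N ∧ cone = PointedCone.hull ℝ (S : Set V)
  strictly_convex : (cone : ConvexCone ℝ V).Salient
  interior_nonempty : (interior (cone : Set V)).Nonempty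

variable {N : Submodule ℤ V}

/-- The monoid `Γ = σ^∨ ∩ M`. -/
def expMonoid (σ : WeightCone N) : AddSubmonoid (Module.Dual ℝ V) where
  carrier := {m | m ∈ dualLattice N ∧ ∀ w ∈ σ.cone, 0 ≤ m w}
  zero_mem' := ⟨(dualLattice N).zero_mem, fun _ _ => le_rfl⟩
  add_mem' := fun ha hb =>
    ⟨(dualLattice N).add_mem ha.1 hb.1, fun w hw => add_nonneg (ha.2 w hw) (hb.2 w hw)⟩

/-- The type of elements of `Γ = σ^∨ ∩ M`. -/
abbrev Exps (σ : WeightCone N) : Type _ := expMonoid σ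

/-- A linear form is determined by its values on a cone with non-empty interior. -/
theorem dual_ext_of_eqOn (σ : WeightCone N) {a b : Module.Dual ℝ V}
    (h : ∀ w ∈ σ.cone, a w = b w) : a = b := by
  obtain ⟨w₀, hw₀⟩ := σ.interior_nonempty
  ext v
  have hc : Filter.Tendsto (fun t : ℝ => w₀ + t • v) (nhds 0) (nhds w₀) := by
    have : Continuous (fun t : ℝ => w₀ + t • v) := by fun_prop
    simpa using this.tendsto 0
  have hev : ∀ᶠ t : ℝ in nhds 0, w₀ + t • v ∈ (σ.cone : Set V) :=
    hc (mem_interior_iff_mem_nhds.mp hw₀)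
  obtain ⟨ε, hε, hball⟩ := Metric.eventually_nhds_iff.mp hev
  have h1 : w₀ + (ε / 2) • v ∈ (σ.cone : Set V) := hball (by
    rw [Real.dist_eq, sub_zero, abs_of_pos (by positivity)]; linarith)
  have h2 := h _ h1
  have h3 := h _ (interior_subset hw₀)
  simp only [map_add, map_smul, smul_eq_mul] at h2
  have h4 : (ε / 2) * a v = (ε / 2) * b v := by linarith
  exact mul_left_cancel₀ (by positivity) h4

/-- The divisibility order of monomials: `a ≤ b` if and only if `b - a ∈ Γ`
(see `Exps.le_iff_exists_add`). -/
instance (σ : WeightCone N) : PartialOrder (Exps σ) where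
  le a b := ∀ w ∈ σ.cone, a.1 w ≤ b.1 w
  le_refl a w _ := le_rfl
  le_trans a b c hab hbc w hw := (hab w hw).trans (hbc w hw)
  le_antisymm a b hab hba :=
    Subtype.ext (dual_ext_of_eqOn σ fun w hw => le_antisymm (hab w hw) (hba w hw))

theorem Exps.le_def {σ : WeightCone N} {a b : Exps σ} :
    a ≤ b ↔ ∀ w ∈ σ.cone, a.1 w ≤ b.1 w := Iff.rfl

theorem Exps.le_iff_exists_add {σ : WeightCone N} {a b : Exps σ} :
    a ≤ b ↔ ∃ c : Exps σ, b = a + c := by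
  constructor
  · intro h
    refine ⟨⟨b.1 - a.1, (dualLattice N).sub_mem b.2.1 a.2.1, fun w hw => ?_⟩, ?_⟩
    · simpa using h w hw
    · apply Subtype.ext
      simp
  · rintro ⟨c, rfl⟩ w hw
    simpa using c.2.2 w hw

instance (σ : WeightCone N) : IsOrderedCancelAddMonoid (Exps σ) where
  add_le_add_left a b hab c w hw := by
    simpa using hab w hw
  le_of_add_le_add_left a b c h w hw := by
    simpa using h w hw

/-- Every set of exponents is partially well-ordered (Dickson's lemma). -/
theorem Exps.isPWO {σ : WeightCone N} (A : Set (Exps σ)) : A.IsPWO := by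
  obtain ⟨S, hSN, hS⟩ := σ.rational_polyhedral
  have hSσ : ∀ s : S, (s : V) ∈ σ.cone := fun s => by
    rw [hS]; exact Submodule.subset_span s.2
  have hval : ∀ (a : Exps σ) (s : S), ∃ k : ℕ, a.1 (s : V) = k := fun a s => by
    obtain ⟨k, hk⟩ := a.2.1 s (hSN s.2)
    have h0 : (0 : ℝ) ≤ k := hk ▸ a.2.2 s (hSσ s)
    lift k to ℕ using (by exact_mod_cast h0)
    exact ⟨k, by simpa using hk⟩
  choose e he using hval
  have hle : ∀ a b : Exps σ, e a ≤ e b → a ≤ b := by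
    intro a b hab w hw
    rw [hS] at hw
    refine Submodule.span_induction (p := fun w _ => a.1 w ≤ b.1 w) ?_ ?_ ?_ ?_ hw
    · intro s hs
      have := hab ⟨s, hs⟩
      have h1 := he a ⟨s, hs⟩
      have h2 := he b ⟨s, hs⟩
      simp only at h1 h2
      rw [h1, h2]
      exact_mod_cast this
    · simp
    · intro x y _ _ hx hy
      simp only [map_add]
      exact add_le_add hx hy
    · intro c x _ hx
      have hc : c • x = (c : ℝ) • x := rfl
      rw [hc, map_smul, map_smul]
      exact mul_le_mul_of_nonneg_left hx c.2
  intro f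
  obtain ⟨i, j, hij, h⟩ := wellQuasiOrdered_le (α := S → ℕ) (fun n => e (f n))
  exact ⟨i, j, hij, hle _ _ h⟩

section Series

variable (K : Type*) [Field K]

/-- The ring `K[[Γ]]` of formal power series with exponents in `Γ`. Since every set of exponents
is partially well-ordered, Hahn series over `Γ` are arbitrary functions `Γ → K`
(see `PSeries.ofCoeff`), with the convolution product. -/
abbrev PSeries (σ : WeightCone N) : Type _ := HahnSeries (Exps σ) K

variable {K} {σ : WeightCone N}

/-- The series `∑ c_m χ^m` with an arbitrary family of coefficients `c : Γ → K`. -/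
def PSeries.ofCoeff (c : Exps σ → K) : PSeries K σ := ⟨c, Exps.isPWO _⟩

variable (K) in
/-- The monomial `χ^m`. -/
def chi (m : Exps σ) : PSeries K σ := HahnSeries.single m 1

/-- The basis `δ_w(f)` of the support of `f` relative to `w`: the locus where `w`, restricted to
the support of `f`, achieves its minimum. -/
def basisRel (w : V) (f : PSeries K σ) : Set (Exps σ) :=
  {m | m ∈ f.support ∧ ∀ m' ∈ f.support, m.1 w ≤ m'.1 w}

open Classical in
/-- The `w`-initial form `in_w f`. -/
def initialForm (w : V) (f : PSeries K σ) : PSeries K σ :=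
  PSeries.ofCoeff fun m => if m ∈ basisRel w f then f.coeff m else 0

/-- The `w`-initial ideal `in_w I`. -/
def initialIdeal (w : V) (I : Ideal (PSeries K σ)) : Ideal (PSeries K σ) :=
  Ideal.span (initialForm w '' (I : Set (PSeries K σ)))

variable (K σ) in
/-- The toric boundary, as a subset of `Spec K[[Γ]]`: the complement of the locus where all the
monomials are invertible. -/
def toricBoundary : Set (PrimeSpectrum (PSeries K σ)) :=
  {p | ∃ m : Exps σ, chi K m ∈ p.asIdeal}

variable (K σ) in
/-- An interior subtoric germ `Y`, given by its defining ideal `I_Y` in `K[[Γ]]`: it is reduced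
and none of its irreducible components is contained in the toric boundary. -/
structure InteriorGerm where
  /-- the defining ideal `I_Y` -/
  ideal : Ideal (PSeries K σ)
  reduced : ideal.IsRadical
  not_subset_boundary : ∀ P ∈ ideal.minimalPrimes,
    ¬ PrimeSpectrum.zeroLocus (P : Set (PSeries K σ)) ⊆ toricBoundary K σ

/-- The set of initial weight vectors of `Y`: the `w` in the interior of `σ` such that the
`w`-initial ideal of `I_Y` does not contain monomials. -/
def InteriorGerm.initialWeights (Y : InteriorGerm K σ) : Set V :=
  {w | w ∈ interior (σ.cone : Set V) ∧ ∀ m : Exps σ, chi K m ∉ initialIdeal w Y.ideal}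

/-- The closure of the union of the rays `ℝ_{≥ 0} w`, for `w ∈ Σ`. -/
def coneClosure (A : Set V) : Set V :=
  closure {v | ∃ w ∈ A, ∃ c : ℝ, 0 ≤ c ∧ v = c • w}

/-- The local tropicalization of an interior subtoric germ. -/
def InteriorGerm.trop (Y : InteriorGerm K σ) : Set V :=
  coneClosure Y.initialWeights

/-- The germ is an effective principal divisor `Z(f)`: its ideal is generated by one
non zero divisor. -/
def InteriorGerm.IsPrincipalEffectiveDivisor (D : InteriorGerm K σ) : Prop :=
  ∃ f ∈ nonZeroDivisors (PSeries K σ), D.ideal = Ideal.span {f}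

/-- `D` contains `Y`. -/
def InteriorGerm.Contains (D Y : InteriorGerm K σ) : Prop := D.ideal ≤ Y.ideal

end Series

end LocTrop

end

/-! Only one inclusion has content: for w₀ in σ outside Trop Y one needs an interior principal
divisor D containing Y with w₀ outside Trop D. For w₀ ≠ 0 it suffices that I_D contain a series one
of whose terms has strictly smallest weight for all interior weights near w₀
(`InteriorGerm.notMem_trop`).

Near w₀ every initial ideal of I_Y contains a monomial, but the series producing it varies with the
weight. `exists_dominant_term` finds one series for a whole neighbourhood by an algebraic
compactness argument. The neighbourhood is a cone given by finitely many conditions m_j > 0 on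
lattice forms, and variables X_j standing for χ^{m_j} are adjoined to K[[Γ]]. If I_Y and the
relations defining the X_j imply no relation "monomial · (non-zero constant + positive terms) = 0",
there is a real semivaluation compatible with all of them and finite on monomials. Its values on
monomials form a weight in the neighbourhood, where the ultrametric inequality contradicts the
presence of a monomial in the initial ideal. Otherwise such a relation, with denominators cleared,
is the wanted series f.

The ideal (f) need not be radical or free of boundary components, so `exists_divisor` perturbs f by
some g in I_Y of high order along w₀, which preserves the dominant term. As K[[Γ]] is a completely
integrally closed Noetherian domain, (h) is radical unless h lies in the second symbolic power of an
associated prime of (h), and these primes are locally principal. A Bertini argument with a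
derivation (`exists_generic_add`) shows that a generic perturbation acquires such a prime only if
all generators of the perturbing ideal lie in its symbolic square, which is impossible because I_Y
is radical. The only boundary divisor that this does not avoid is the one attached to w₀ itself;
`exists_notMem_faceIdeal` first multiplies f by a quotient of monomials to leave it. -/

noncomputable section

namespace LocTrop

/-! ### Polyhedral geometry of σ and finiteness properties of Γ. -/

section Geometry

open Filter Topology

variable {V : Type*} [NormedAddCommGroup V] [NormedSpace ℝ V] {N : Submodule ℤ V}

theorem WeightCone.exists_generators (σ : WeightCone N) :
    ∃ S : Finset V, (∀ s ∈ S, s ∈ N ∧ s ≠ 0 ∧ s ∈ σ.cone) ∧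
      ∀ v ∈ σ.cone, ∃ c : V → ℝ, (∀ s, 0 ≤ c s) ∧ v = ∑ s ∈ S, c s • s := by
  classical
  obtain ⟨S, hSN, hS⟩ := σ.rational_polyhedral
  refine ⟨S.erase 0, fun s hs => ?_, fun v hv => ?_⟩
  · rw [Finset.mem_erase] at hs
    exact ⟨hSN hs.2, hs.1, by rw [hS]; exact Submodule.subset_span hs.2⟩
  · rw [hS] at hv
    induction hv using Submodule.span_induction with
    | mem x hx =>
      by_cases h0 : x = 0
      · exact ⟨0, fun _ => le_rfl, by simp [h0]⟩
      · refine ⟨fun s => if s = x then 1 else 0, fun s => by positivity, ?_⟩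
        rw [Finset.sum_eq_single x]
        · simp
        · intro b _ hb; simp [hb]
        · intro h; exact absurd (Finset.mem_erase.mpr ⟨h0, hx⟩) h
    | zero => exact ⟨0, fun _ => le_rfl, by simp⟩
    | add x y _ _ hx hy =>
      obtain ⟨c, hc, rfl⟩ := hx
      obtain ⟨d, hd, rfl⟩ := hy
      exact ⟨c + d, fun s => add_nonneg (hc s) (hd s), by simp [add_smul, Finset.sum_add_distrib]⟩
    | smul a x _ hx =>
      obtain ⟨c, hc, rfl⟩ := hx
      refine ⟨fun s => a.1 * c s, fun s => mul_nonneg a.2 (hc s), ?_⟩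
      rw [Finset.smul_sum]
      refine Finset.sum_congr rfl fun s _ => ?_
      rw [mul_smul]; rfl

/-- The non-zero generators of a weight cone. -/
def WeightCone.gens (σ : WeightCone N) : Finset V := σ.exists_generators.choose

theorem WeightCone.gens_mem_lattice (σ : WeightCone N) {s : V} (hs : s ∈ σ.gens) : s ∈ N :=
  (σ.exists_generators.choose_spec.1 s hs).1

theorem WeightCone.gens_ne_zero (σ : WeightCone N) {s : V} (hs : s ∈ σ.gens) : s ≠ 0 :=
  (σ.exists_generators.choose_spec.1 s hs).2.1

theorem WeightCone.gens_mem_cone (σ : WeightCone N) {s : V} (hs : s ∈ σ.gens) : s ∈ σ.cone :=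
  (σ.exists_generators.choose_spec.1 s hs).2.2

theorem WeightCone.exists_combination (σ : WeightCone N) {v : V} (hv : v ∈ σ.cone) :
    ∃ c : V → ℝ, (∀ s, 0 ≤ c s) ∧ v = ∑ s ∈ σ.gens, c s • s :=
  σ.exists_generators.choose_spec.2 v hv

theorem WeightCone.smul_mem (σ : WeightCone N) {v : V} (hv : v ∈ σ.cone) {c : ℝ} (hc : 0 ≤ c) :
    c • v ∈ σ.cone :=
  σ.cone.smul_mem hc hv

theorem WeightCone.combination_mem (σ : WeightCone N) {c : V → ℝ} (hc : ∀ s ∈ σ.gens, 0 ≤ c s) :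
    ∑ s ∈ σ.gens, c s • s ∈ σ.cone :=
  σ.cone.sum_mem fun s hs => σ.smul_mem (σ.gens_mem_cone hs) (hc s hs)

theorem WeightCone.nonneg_of_gens (σ : WeightCone N) {m : Module.Dual ℝ V}
    (h : ∀ s ∈ σ.gens, 0 ≤ m s) {w : V} (hw : w ∈ σ.cone) : 0 ≤ m w := by
  obtain ⟨c, hc, rfl⟩ := σ.exists_combination hw
  rw [map_sum]
  exact Finset.sum_nonneg fun s hs => by
    rw [map_smul]; exact mul_nonneg (hc s) (h s hs)

theorem mem_expMonoid_of_gens (σ : WeightCone N) {m : Module.Dual ℝ V} (hm : m ∈ dualLattice N)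
    (h : ∀ s ∈ σ.gens, 0 ≤ m s) : m ∈ expMonoid σ :=
  ⟨hm, fun _ hw => σ.nonneg_of_gens h hw⟩

theorem Exps.zero_le {σ : WeightCone N} (a : Exps σ) : 0 ≤ a := fun w hw => a.2.2 w hw

instance (σ : WeightCone N) : WellFoundedLT (Exps σ) :=
  Set.isWF_univ_iff.mp (Exps.isPWO (σ := σ) Set.univ).isWF

/-- The minimal elements of a set of exponents form a finite set, and every exponent of the set is
above one of them. -/
theorem Exps.exists_finset_le {σ : WeightCone N} (A : Set (Exps σ)) :
    ∃ T : Finset (Exps σ), (T : Set (Exps σ)) ⊆ A ∧ ∀ a ∈ A, ∃ t ∈ T, t ≤ a := by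
  have hfin : {a | Minimal (· ∈ A) a}.Finite :=
    (setOfPred_minimal_antichain _).finite_of_partiallyWellOrderedOn (Exps.isPWO _)
  refine ⟨hfin.toFinset, fun a ha => ?_, fun a ha => ?_⟩
  · simp only [Set.Finite.coe_toFinset, Set.mem_ofPred_eq] at ha
    exact ha.1
  · obtain ⟨b, hb, hmin⟩ := exists_minimal_le_of_wellFoundedLT (· ∈ A) a ha
    exact ⟨b, by simpa using hmin, hb⟩

/-- Gordan's lemma: by Dickson's lemma the minimal non-zero exponents are finitely many, and
subtracting them one at a time terminates by well-foundedness. -/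
theorem Exps.exists_finset_closure_eq_top (σ : WeightCone N) :
    ∃ A : Finset (Exps σ), (∀ a ∈ A, a ≠ 0) ∧ AddSubmonoid.closure (A : Set (Exps σ)) = ⊤ := by
  obtain ⟨T, hT, hle⟩ := Exps.exists_finset_le {a : Exps σ | a ≠ 0}
  refine ⟨T, fun a ha => hT ha, ?_⟩
  rw [eq_top_iff]
  rintro m -
  induction m using WellFoundedLT.induction with
  | ind m ih =>
    by_cases hm : m = 0
    · rw [hm]; exact zero_mem _
    · obtain ⟨t, ht, htm⟩ := hle m hm
      obtain ⟨c, rfl⟩ := Exps.le_iff_exists_add.mp htm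
      refine add_mem (AddSubmonoid.subset_closure ht) (ih c ?_)
      refine lt_of_le_of_ne (Exps.le_iff_exists_add.mpr ⟨t, add_comm _ _⟩) fun h => hT ht ?_
      exact add_right_cancel (b := c) (by rw [zero_add]; exact h.symm)

theorem one_le_of_dualLattice {m : Module.Dual ℝ V} (hm : m ∈ dualLattice N) {x : V} (hx : x ∈ N)
    (h : 0 < m x) : 1 ≤ m x := by
  obtain ⟨k, hk⟩ := hm x hx
  rw [hk] at h ⊢
  exact_mod_cast h

/-- By strict convexity, 0 is not in the compact convex hull of the non-zero generators, so it can
be separated from it strictly. -/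
theorem WeightCone.exists_dual_pos (σ : WeightCone N) :
    ∃ l : Module.Dual ℝ V, ∀ s ∈ σ.gens, 0 < l s := by
  have hc : IsCompact (convexHull ℝ (σ.gens : Set V)) := σ.gens.finite_toSet.isCompact_convexHull ℝ
  have h0 : (0 : V) ∉ convexHull ℝ (σ.gens : Set V) := by
    intro h
    rw [Finset.mem_convexHull'] at h
    obtain ⟨c, hc0, hc1, hc2⟩ := h
    obtain ⟨s, hs, hs0⟩ : ∃ s ∈ σ.gens, c s ≠ 0 := by
      by_contra! hcon
      rw [Finset.sum_eq_zero hcon] at hc1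
      exact zero_ne_one hc1
    classical
    rw [← Finset.add_sum_erase _ _ hs] at hc2
    refine σ.strictly_convex (c s • s) (σ.smul_mem (σ.gens_mem_cone hs) (hc0 s hs))
      (smul_ne_zero hs0 (σ.gens_ne_zero hs)) ?_
    rw [neg_eq_of_add_eq_zero_right hc2]
    exact σ.cone.sum_mem fun t ht => σ.smul_mem (σ.gens_mem_cone (Finset.mem_of_mem_erase ht))
      (hc0 t (Finset.mem_of_mem_erase ht))
  obtain ⟨f, u, hu, hf⟩ := geometric_hahn_banach_point_closed (convex_convexHull ℝ _) hc.isClosed h0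
  refine ⟨f.toLinearMap, fun s hs => ?_⟩
  have := hf s (subset_convexHull ℝ _ hs)
  rw [map_zero] at hu
  exact hu.trans this

/-! ### Rational approximation, the height exponent and compactness. -/

section Lattice

variable [FiniteDimensional ℝ V] [DiscreteTopology N] [IsZLattice ℝ N]

variable (N) in
theorem exists_lattice_basis : ∃ (n : ℕ) (b : Module.Basis (Fin n) ℝ V),
    (∀ i, b i ∈ N) ∧ ∀ i, b.coord i ∈ dualLattice N := by
  have := ZLattice.module_finite ℝ N
  have := ZLattice.module_free ℝ N
  let b := Module.finBasis ℤ N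
  refine ⟨_, b.ofZLatticeBasis ℝ N, fun i => ?_, fun i x hx => ⟨b.repr ⟨x, hx⟩ i, ?_⟩⟩
  · rw [Module.Basis.ofZLatticeBasis_apply]; exact (b i).2
  · exact b.ofZLatticeBasis_repr_apply ℝ N ⟨x, hx⟩ i

/-- A large multiple D·l is rounded down in a lattice basis; the error at t is at most the sum of
the absolute coordinates of t, independently of D. -/
theorem exists_mem_dualLattice_pos (T : Finset V) (l : Module.Dual ℝ V) (h : ∀ t ∈ T, 0 < l t) :
    ∃ m ∈ dualLattice N, ∀ t ∈ T, 0 < m t := by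
  obtain ⟨n, b, -, hb⟩ := exists_lattice_basis N
  have hev : ∀ᶠ D : ℕ in atTop, ∀ t ∈ T, ∑ i, |b.coord i t| < D * l t := by
    rw [Filter.eventually_all_finset]
    intro t ht
    exact ((tendsto_natCast_atTop_atTop (R := ℝ)).atTop_mul_const (h t ht)).eventually_gt_atTop _
  obtain ⟨D, hD⟩ := hev.exists
  refine ⟨∑ i, ⌊D * l (b i)⌋ • b.coord i, sum_mem fun i _ => zsmul_mem (hb i) _, fun t ht => ?_⟩
  have h1 : l t = ∑ i, l (b i) * b.coord i t := by
    conv_lhs => rw [← b.sum_repr t, map_sum]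
    exact Finset.sum_congr rfl fun i _ => by rw [map_smul, smul_eq_mul, mul_comm]; rfl
  have h2 : D * l t - ∑ i, |b.coord i t| ≤ (∑ i, ⌊D * l (b i)⌋ • b.coord i : Module.Dual ℝ V) t := by
    rw [h1, Finset.mul_sum, ← Finset.sum_sub_distrib, LinearMap.sum_apply]
    refine Finset.sum_le_sum fun i _ => ?_
    have h3 := Int.fract_nonneg (D * l (b i))
    have h4 := Int.fract_lt_one (D * l (b i))
    have h5 : ((⌊D * l (b i)⌋ • b.coord i : Module.Dual ℝ V) t)
        = (D * l (b i) - Int.fract (D * l (b i))) * b.coord i t := by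
      rw [Int.self_sub_fract, LinearMap.smul_apply, zsmul_eq_mul]
    rw [h5, sub_mul, ← mul_assoc]
    have h6 : Int.fract (D * l (b i)) * b.coord i t ≤ |b.coord i t| :=
      (le_abs_self _).trans (by
        rw [abs_mul, abs_of_nonneg h3]
        exact mul_le_of_le_one_left (abs_nonneg _) h4.le)
    linarith
  linarith [hD t ht]

theorem WeightCone.exists_height (σ : WeightCone N) :
    ∃ m : Exps σ, ∀ s ∈ σ.gens, 0 < m.1 s := by
  obtain ⟨l, hl⟩ := σ.exists_dual_pos
  obtain ⟨m, hm, hpos⟩ := exists_mem_dualLattice_pos (N := N) σ.gens l hl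
  exact ⟨⟨m, mem_expMonoid_of_gens σ hm fun s hs => (hpos s hs).le⟩, hpos⟩

/-- An exponent which is positive on the non-zero vectors of the cone. -/
def WeightCone.height (σ : WeightCone N) : Exps σ := σ.exists_height.choose

theorem WeightCone.height_pos_gens (σ : WeightCone N) {s : V} (hs : s ∈ σ.gens) :
    0 < σ.height.1 s := σ.exists_height.choose_spec s hs

theorem WeightCone.height_pos (σ : WeightCone N) {w : V} (hw : w ∈ σ.cone) (h0 : w ≠ 0) :
    0 < σ.height.1 w := by
  obtain ⟨c, hc, rfl⟩ := σ.exists_combination hw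
  rw [map_sum]
  obtain ⟨s, hs, hs0⟩ : ∃ s ∈ σ.gens, c s ≠ 0 := by
    by_contra! hcon
    exact h0 (Finset.sum_eq_zero fun s hs => by rw [hcon s hs, zero_smul])
  refine Finset.sum_pos' (fun t ht => ?_) ⟨s, hs, ?_⟩ <;> rw [map_smul, smul_eq_mul]
  · exact mul_nonneg (hc t) (σ.height_pos_gens ht).le
  · exact mul_pos (lt_of_le_of_ne (hc s) hs0.symm) (σ.height_pos_gens hs)

/-- The height is a positive integer on each generator, so its multiples absorb any lattice form.
Hence every lattice form is a difference of exponents, and every monomial divides a power of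
χ^height. -/
theorem WeightCone.exists_add_height (σ : WeightCone N) {m : Module.Dual ℝ V}
    (hm : m ∈ dualLattice N) : ∃ k : ℕ, m + k • σ.height.1 ∈ expMonoid σ := by
  obtain ⟨k, hk⟩ := exists_nat_ge (∑ s ∈ σ.gens, |m s|)
  refine ⟨k, mem_expMonoid_of_gens σ (add_mem hm (nsmul_mem σ.height.2.1 k)) fun s hs => ?_⟩
  have h1 : |m s| ≤ k := (Finset.single_le_sum (fun t _ => abs_nonneg (m t)) hs).trans hk
  have h2 := one_le_of_dualLattice σ.height.2.1 (σ.gens_mem_lattice hs) (σ.height_pos_gens hs)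
  have h3 : (k : ℝ) ≤ k * σ.height.1 s := le_mul_of_one_le_right (by positivity) h2
  have h4 := neg_abs_le (m s)
  simp only [LinearMap.add_apply, LinearMap.smul_apply, nsmul_eq_mul]
  linarith

theorem continuous_dual (m : Module.Dual ℝ V) : Continuous m :=
  LinearMap.continuous_of_finiteDimensional m

theorem WeightCone.exists_isCompact (σ : WeightCone N) (R : ℝ) :
    ∃ C : Set V, IsCompact C ∧ C ⊆ (σ.cone : Set V) ∧ ∀ v ∈ σ.cone, σ.height.1 v ≤ R → v ∈ C := by
  -- The box is indexed by all of V; the absolute value keeps 0 in every interval, also at vectors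
  -- that are not generators.
  let box : Set (V → ℝ) := Set.pi Set.univ fun s => Set.Icc 0 |R / σ.height.1 s|
  have hbox : IsCompact box := isCompact_univ_pi fun s => isCompact_Icc
  refine ⟨(fun c : V → ℝ => ∑ s ∈ σ.gens, c s • s) '' box, hbox.image (by fun_prop), ?_, ?_⟩
  · rintro _ ⟨c, hc, rfl⟩
    exact σ.combination_mem fun s _ => (hc s trivial).1
  · intro v hv hR
    obtain ⟨c, hc, rfl⟩ := σ.exists_combination hv
    classical
    have hsum : ∀ s ∈ σ.gens, c s * σ.height.1 s ≤ R := fun s hs => by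
      rw [map_sum] at hR
      refine le_trans ?_ hR
      rw [← smul_eq_mul, ← map_smul]
      refine Finset.single_le_sum (f := fun s => σ.height.1 (c s • s)) (fun t ht => ?_) hs
      rw [map_smul]
      exact mul_nonneg (hc t) (σ.height_pos_gens ht).le
    refine ⟨fun s => if s ∈ σ.gens then c s else 0, fun s _ => ?_, ?_⟩
    · by_cases hs : s ∈ σ.gens
      · simp only [hs, if_true]
        exact ⟨hc s, ((le_div_iff₀ (σ.height_pos_gens hs)).mpr (hsum s hs)).trans (le_abs_self _)⟩
      · simp [hs]
    · exact Finset.sum_congr rfl fun s hs => by simp [hs]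

end Lattice

end Geometry

/-! ### Interior weights, duality between σ and Γ, and rational neighbourhoods of rays. -/

section WeightVectors

open Filter Topology

variable {V : Type*} [NormedAddCommGroup V] [NormedSpace ℝ V] {N : Submodule ℤ V}

/-- A form that is non-negative on σ and vanishes at an interior point is non-negative in all
directions, hence zero. -/
theorem WeightCone.exps_pos_of_mem_interior (σ : WeightCone N) {w : V}
    (hw : w ∈ interior (σ.cone : Set V)) {m : Exps σ} (hm : m ≠ 0) : 0 < m.1 w := by
  refine lt_of_le_of_ne (m.2.2 w (interior_subset hw)) fun h0 => hm ?_
  refine Subtype.ext (LinearMap.ext fun v => ?_)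
  have key : ∀ v : V, 0 ≤ m.1 v := by
    intro v
    have hc : Filter.Tendsto (fun t : ℝ => w + t • v) (nhds 0) (nhds w) := by
      have : Continuous (fun t : ℝ => w + t • v) := by fun_prop
      simpa using this.tendsto 0
    have hev : ∀ᶠ t : ℝ in nhds 0, w + t • v ∈ (σ.cone : Set V) :=
      hc (mem_interior_iff_mem_nhds.mp hw)
    obtain ⟨ε, hε, hball⟩ := Metric.eventually_nhds_iff.mp hev
    have h1 : w + (ε / 2) • v ∈ (σ.cone : Set V) := hball (by
      rw [Real.dist_eq, sub_zero, abs_of_pos (by positivity)]; linarith)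
    have h2 := m.2.2 _ h1
    rw [map_add, map_smul, ← h0, zero_add, smul_eq_mul] at h2
    exact nonneg_of_mul_nonneg_right h2 (by positivity)
  have h1 := key v
  have h2 := key (-v)
  rw [map_neg] at h2
  exact le_antisymm (neg_nonneg.mp h2) h1

theorem WeightCone.subset_closure_interior (σ : WeightCone N) :
    (σ.cone : Set V) ⊆ closure (interior (σ.cone : Set V)) := by
  rw [(σ.cone.convex).closure_interior_eq_closure_of_nonempty_interior σ.interior_nonempty]
  exact subset_closure

variable [FiniteDimensional ℝ V] [DiscreteTopology N] [IsZLattice ℝ N]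

theorem WeightCone.isClosed (σ : WeightCone N) : IsClosed (σ.cone : Set V) := by
  rw [← closure_subset_iff_isClosed]
  intro v hv
  obtain ⟨C, hC, hCσ, hsub⟩ := σ.exists_isCompact (σ.height.1 v + 1)
  have hopen : IsOpen {x | σ.height.1 x < σ.height.1 v + 1} :=
    isOpen_lt (continuous_dual _) continuous_const
  have h1 : v ∈ closure ({x | σ.height.1 x < σ.height.1 v + 1} ∩ (σ.cone : Set V)) :=
    hopen.inter_closure ⟨lt_add_one (σ.height.1 v), hv⟩
  have h2 : v ∈ closure C := closure_mono (fun x hx => hsub x hx.2 (le_of_lt hx.1)) h1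
  rw [hC.isClosed.closure_eq] at h2
  exact hCσ h2

theorem WeightCone.isCompact_slice (σ : WeightCone N) (r : ℝ) :
    IsCompact {v | v ∈ σ.cone ∧ σ.height.1 v = r} := by
  obtain ⟨C, hC, -, hsub⟩ := σ.exists_isCompact r
  refine hC.of_isClosed_subset ?_ fun v hv => hsub v hv.1 hv.2.le
  exact σ.isClosed.inter (isClosed_eq (continuous_dual _) continuous_const)

/-- A vector outside of the cone is detected by an exponent. -/
theorem WeightCone.exists_exps_neg (σ : WeightCone N) {v : V} (hv : v ∉ σ.cone) :
    ∃ m : Exps σ, m.1 v < 0 := by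
  have hconv : Convex ℝ (σ.cone : Set V) := σ.cone.convex
  obtain ⟨f, u, hfv, hf⟩ := geometric_hahn_banach_point_closed hconv σ.isClosed hv
  have hu : u < 0 := by simpa using hf 0 σ.cone.zero_mem
  have hpos : ∀ s ∈ σ.cone, 0 ≤ f s := by
    intro s hs
    by_contra! hneg
    have h1 := hf _ (σ.smul_mem hs (c := u / f s) (div_nonneg_of_nonpos hu.le hneg.le))
    rw [map_smul, smul_eq_mul, div_mul_cancel₀ _ hneg.ne] at h1
    exact lt_irrefl _ h1
  -- A small multiple of the height makes f strictly positive on the generators while it stays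
  -- negative at v, so rounding to a lattice form keeps the signs.
  obtain ⟨ε, hε, hεv⟩ : ∃ ε : ℝ, 0 < ε ∧ f v + ε * σ.height.1 v < 0 := by
    refine ⟨-f v / (2 * (|σ.height.1 v| + 1)), div_pos (by linarith) (by positivity), ?_⟩
    have h1 : -f v / (2 * (|σ.height.1 v| + 1)) * σ.height.1 v ≤ -f v / 2 := by
      rw [div_mul_eq_mul_div, div_le_div_iff₀ (by positivity) (by norm_num)]
      nlinarith [le_abs_self (σ.height.1 v), abs_nonneg (σ.height.1 v)]
    linarith
  classical
  obtain ⟨m, hm, hpos'⟩ := exists_mem_dualLattice_pos (N := N) (insert (-v) σ.gens)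
    (f.toLinearMap + ε • σ.height.1) (by
      intro t ht
      rw [Finset.mem_insert] at ht
      rcases ht with rfl | ht
      · simp only [LinearMap.add_apply, LinearMap.smul_apply, map_neg, smul_eq_mul]
        simp only [ContinuousLinearMap.coe_coe]
        linarith
      · exact add_pos_of_nonneg_of_pos (hpos t (σ.gens_mem_cone ht))
          (mul_pos hε (σ.height_pos_gens ht)))
  refine ⟨⟨m, mem_expMonoid_of_gens σ hm fun s hs => (hpos' s (Finset.mem_insert_of_mem hs)).le⟩, ?_⟩
  have := hpos' (-v) (Finset.mem_insert_self _ _)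
  rw [map_neg] at this
  exact neg_pos.mp this

theorem WeightCone.mem_of_exps_nonneg (σ : WeightCone N) {v : V} (h : ∀ m : Exps σ, 0 ≤ m.1 v) :
    v ∈ σ.cone := by
  by_contra hv
  obtain ⟨m, hm⟩ := σ.exists_exps_neg hv
  exact absurd (h m) (not_le.mpr hm)

/-- Finitely many exponents generate Γ, and their positivity defines an open subset of σ. -/
theorem WeightCone.mem_interior_of_exps_pos (σ : WeightCone N) {w : V}
    (h : ∀ m : Exps σ, m ≠ 0 → 0 < m.1 w) : w ∈ interior (σ.cone : Set V) := by
  obtain ⟨A, hA, hcl⟩ := Exps.exists_finset_closure_eq_top σ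
  refine mem_interior.mpr ⟨⋂ a ∈ A, {v | 0 < a.1 v}, fun v hv => ?_, ?_, ?_⟩
  · refine σ.mem_of_exps_nonneg fun m => ?_
    have hm : m ∈ AddSubmonoid.closure (A : Set (Exps σ)) := by rw [hcl]; trivial
    induction hm using AddSubmonoid.closure_induction with
    | mem a ha => exact le_of_lt (Set.mem_iInter₂.mp hv a ha)
    | zero => exact le_rfl
    | add a b _ _ ha hb => exact add_nonneg ha hb
  · exact isOpen_biInter_finset fun a _ => isOpen_lt continuous_const (continuous_dual _)
  · exact Set.mem_iInter₂.mpr fun a ha => h a (hA a ha)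

theorem WeightCone.smul_mem_interior (σ : WeightCone N) {w : V}
    (hw : w ∈ interior (σ.cone : Set V)) {c : ℝ} (hc : 0 < c) :
    c • w ∈ interior (σ.cone : Set V) :=
  σ.mem_interior_of_exps_pos fun m hm => by
    rw [map_smul]; exact mul_pos hc (σ.exps_pos_of_mem_interior hw hm)

/-- Every additive function on the exponents is the evaluation at a weight vector. -/
theorem WeightCone.exists_weight (σ : WeightCone N) (l : Exps σ →+ ℝ) :
    ∃ w : V, ∀ m : Exps σ, m.1 w = l m := by
  obtain ⟨n, b, hbN, hb⟩ := exists_lattice_basis N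
  choose k hk using fun i => σ.exists_add_height (hb i)
  let c : Fin n → Exps σ := fun i => ⟨_, hk i⟩
  -- The i-th coordinate form is c i - k i • height, so these are the values forced on the extension
  -- of l to the dual lattice.
  refine ⟨∑ i, (l (c i) - k i * l σ.height) • b i, fun m => ?_⟩
  choose z hz using fun i => m.2.1 (b i) (hbN i)
  have hm : m.1 = ∑ i, z i • b.coord i := by
    refine b.ext fun j => ?_
    rw [hz j, LinearMap.sum_apply, Finset.sum_eq_single j]
    · simp
    · intro i _ hij; simp [hij]
    · simp
  -- As l is defined on Γ only, the expansion of m in coordinate forms is rewritten with all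
  -- negative terms moved to the other side.
  have hadd : m + ∑ i, ((z i)⁻.toNat • c i + ((z i)⁺.toNat * k i) • σ.height)
      = ∑ i, ((z i)⁺.toNat • c i + ((z i)⁻.toNat * k i) • σ.height) := by
    apply Subtype.ext
    simp only [AddSubmonoid.coe_add, AddSubmonoid.coe_finsetSum, AddSubmonoidClass.coe_nsmul, c]
    rw [hm, ← Finset.sum_add_distrib]
    refine Finset.sum_congr rfl fun i _ => ?_
    have h1 : z i = ((z i)⁺.toNat : ℤ) - ((z i)⁻.toNat : ℤ) := by
      rw [Int.toNat_of_nonneg (posPart_nonneg _), Int.toNat_of_nonneg (negPart_nonneg _),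
        posPart_sub_negPart]
    generalize (z i)⁺.toNat = p at *
    generalize (z i)⁻.toNat = q at *
    rw [h1, sub_smul, natCast_zsmul, natCast_zsmul, smul_add, smul_add, mul_smul, mul_smul]
    abel
  have hl := congrArg l hadd
  simp only [map_add, map_sum, map_nsmul, nsmul_eq_mul] at hl
  rw [map_sum, eq_comm, ← add_left_inj (∑ i, (((z i)⁻.toNat : ℝ) * l (c i)
    + (((z i)⁺.toNat * k i : ℕ) : ℝ) * l σ.height)), hl, ← Finset.sum_add_distrib]
  refine Finset.sum_congr rfl fun i _ => ?_
  rw [map_smul, hz i, smul_eq_mul]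
  have h1 : (z i : ℝ) = ((z i)⁺.toNat : ℝ) - ((z i)⁻.toNat : ℝ) := by
    have : z i = ((z i)⁺.toNat : ℤ) - ((z i)⁻.toNat : ℤ) := by
      rw [Int.toNat_of_nonneg (posPart_nonneg _), Int.toNat_of_nonneg (negPart_nonneg _),
        posPart_sub_negPart]
    exact_mod_cast this
  rw [h1]
  push_cast
  ring

/-- A neighbourhood of the ray spanned by a non-zero vector of the cone contains a neighbourhood
cut out by finitely many lattice inequalities. -/
theorem WeightCone.exists_finset_cone_subset (σ : WeightCone N) {w₀ : V} (hw₀ : w₀ ∈ σ.cone)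
    (h0 : w₀ ≠ 0) {U : Set V} (hU : IsOpen U) (hwU : w₀ ∈ U) :
    ∃ F : Finset (Module.Dual ℝ V), (∀ m ∈ F, m ∈ dualLattice N ∧ 0 < m w₀) ∧
      ∀ w ∈ σ.cone, (∀ m ∈ F, 0 < m w) → ∃ c : ℝ, 0 < c ∧ c • w ∈ U := by
  classical
  set r := σ.height.1 w₀ with hr
  have hr0 : 0 < r := σ.height_pos hw₀ h0
  have hK : IsCompact ({v | v ∈ σ.cone ∧ σ.height.1 v = r} \ U) :=
    (σ.isCompact_slice r).diff hU
  have hex : ∀ v ∈ ({v | v ∈ σ.cone ∧ σ.height.1 v = r} \ U),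
      ∃ m ∈ dualLattice N, 0 < m w₀ ∧ m v < 0 := by
    rintro v ⟨⟨hv, hvr⟩, hvU⟩
    have hne : v ≠ w₀ := fun h => hvU (h ▸ hwU)
    obtain ⟨f, hf⟩ := geometric_hahn_banach_point_point hne
    -- The height equals r at both v and w₀. Subtracting this multiple of it turns the separating
    -- level (f v + f w₀)/2 into 0, giving a linear form positive at w₀ and negative at v.
    obtain ⟨m, hm, hpos⟩ := exists_mem_dualLattice_pos (N := N) {w₀, -v}
      (f.toLinearMap - ((f v + f w₀) / (2 * r)) • σ.height.1) (by
        intro t ht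
        simp only [Finset.mem_insert, Finset.mem_singleton] at ht
        have h2 : (f v + f w₀) / (2 * r) * r = (f v + f w₀) / 2 := by field_simp
        rcases ht with rfl | rfl
        · simp only [LinearMap.sub_apply, LinearMap.smul_apply, smul_eq_mul,
            ContinuousLinearMap.coe_coe, ← hr, h2]
          linarith
        · simp only [LinearMap.sub_apply, LinearMap.smul_apply, smul_eq_mul, map_neg,
            ContinuousLinearMap.coe_coe, hvr, h2]
          linarith)
    refine ⟨m, hm, hpos _ (by simp), ?_⟩
    have := hpos (-v) (by simp)
    rw [map_neg] at this
    exact neg_pos.mp this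
  choose! g hgN hg0 hgv using hex
  obtain ⟨t, htK, ht⟩ := hK.elim_nhds_subcover (fun v => {x | g v x < 0}) fun v hv =>
    (isOpen_lt (continuous_dual _) continuous_const).mem_nhds (hgv v hv)
  -- The height is included to exclude w = 0, so that w can be rescaled into the slice.
  refine ⟨insert σ.height.1 (t.image g), ?_, fun w hw hpos => ?_⟩
  · intro m hm
    rw [Finset.mem_insert, Finset.mem_image] at hm
    rcases hm with rfl | ⟨v, hv, rfl⟩
    · exact ⟨σ.height.2.1, hr0⟩
    · exact ⟨hgN v (htK v hv), hg0 v (htK v hv)⟩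
  · have hw0 : 0 < σ.height.1 w := hpos _ (Finset.mem_insert_self _ _)
    have hc : 0 < r / σ.height.1 w := div_pos hr0 hw0
    refine ⟨_, hc, ?_⟩
    by_contra hcU
    have hmem := ht ⟨⟨σ.smul_mem hw hc.le, by
      rw [map_smul, smul_eq_mul, div_mul_cancel₀ _ hw0.ne']⟩, hcU⟩
    obtain ⟨v, hv, hlt⟩ := Set.mem_iUnion₂.mp hmem
    have h1 := hpos (g v) (Finset.mem_insert_of_mem (Finset.mem_image_of_mem g hv))
    have h2 : g v ((r / σ.height.1 w) • w) < 0 := hlt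
    rw [map_smul] at h2
    exact absurd h2 (not_lt.mpr (mul_pos hc h1).le)

/-- If no non-zero vector of the cone has strictly more vanishing exponents than `w₀`, then `w₀`
spans a ray, and the other generators are positive on an exponent which vanishes on `w₀`. -/
theorem WeightCone.exists_facet_exponent (σ : WeightCone N) {w₀ : V} (hw₀ : w₀ ∈ σ.cone)
    (h0 : w₀ ≠ 0)
    (hmin : ∀ u ∈ σ.cone, u ≠ 0 → (∀ m : Exps σ, m.1 w₀ = 0 → m.1 u = 0) →
      ∀ m : Exps σ, m.1 u = 0 → m.1 w₀ = 0) :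
    ∃ m : Exps σ, m.1 w₀ = 0 ∧ ∀ s ∈ σ.gens, (∃ c : ℝ, 0 ≤ c ∧ s = c • w₀) ∨ 0 < m.1 s := by
  have key : ∀ s ∈ σ.gens, ∃ m : Exps σ, m.1 w₀ = 0 ∧ ((∃ c : ℝ, 0 ≤ c ∧ s = c • w₀) ∨ 0 < m.1 s) := by
    intro s hs
    by_cases hm : ∃ m : Exps σ, m.1 w₀ = 0 ∧ 0 < m.1 s
    · obtain ⟨m, h1, h2⟩ := hm
      exact ⟨m, h1, Or.inr h2⟩
    · refine ⟨0, rfl, Or.inl ?_⟩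
      have hvan : ∀ m : Exps σ, m.1 w₀ = 0 → m.1 s = 0 := fun m h => by
        by_contra hne
        exact hm ⟨m, h, lt_of_le_of_ne (m.2.2 s (σ.gens_mem_cone hs)) (Ne.symm hne)⟩
      -- subtract from `s` the largest possible multiple of `w₀`
      obtain ⟨A, -, hcl⟩ := Exps.exists_finset_closure_eq_top σ
      have hA : ∀ v : V, (∀ a ∈ A, 0 ≤ a.1 v) → v ∈ σ.cone := fun v hv => by
        refine σ.mem_of_exps_nonneg fun m => ?_
        have hm : m ∈ AddSubmonoid.closure (A : Set (Exps σ)) := by rw [hcl]; trivial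
        induction hm using AddSubmonoid.closure_induction with
        | mem a ha => exact hv a ha
        | zero => exact le_rfl
        | add a b _ _ ha hb => exact add_nonneg ha hb
      classical
      have hne : (A.filter fun a => 0 < a.1 w₀).Nonempty := by
        by_contra hcon
        rw [Finset.not_nonempty_iff_eq_empty, Finset.filter_eq_empty_iff] at hcon
        refine σ.strictly_convex w₀ hw₀ h0 (hA _ fun a ha => ?_)
        have := not_lt.mp (hcon ha)
        rw [map_neg]
        linarith
      obtain ⟨a, ha, hmina⟩ := Finset.exists_min_image _ (fun a : Exps σ => a.1 s / a.1 w₀) hne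
      rw [Finset.mem_filter] at ha
      set t := a.1 s / a.1 w₀ with ht
      have ht0 : 0 ≤ t := div_nonneg (a.2.2 s (σ.gens_mem_cone hs)) ha.2.le
      have hu : s - t • w₀ ∈ σ.cone := by
        refine hA _ fun a' ha' => ?_
        rw [map_sub, map_smul, smul_eq_mul, sub_nonneg]
        rcases (a'.2.2 w₀ hw₀).lt_or_eq with h | h
        · exact (le_div_iff₀ h).mp (hmina a' (Finset.mem_filter.mpr ⟨ha', h⟩))
        · change 0 = a'.1 w₀ at h
          rw [← h, mul_zero]
          exact a'.2.2 s (σ.gens_mem_cone hs)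
      refine ⟨t, ht0, ?_⟩
      by_contra hst
      -- The exponent a realizing the minimal ratio vanishes on s - t • w₀ but not on w₀, against
      -- `hmin`.
      have h1 := hmin _ hu (sub_ne_zero.mpr hst) (fun m hm => by
        rw [map_sub, map_smul, hm, hvan m hm, smul_zero, sub_zero]) a (by
        rw [map_sub, map_smul, smul_eq_mul, ht, div_mul_cancel₀ _ ha.2.ne', sub_self])
      exact ha.2.ne' h1
  choose! g hg0 hg using key
  refine ⟨∑ s ∈ σ.gens, g s, ?_, fun s hs => ?_⟩
  · rw [AddSubmonoid.coe_finsetSum, LinearMap.sum_apply]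
    exact Finset.sum_eq_zero hg0
  · refine (hg s hs).imp_right fun h => ?_
    rw [AddSubmonoid.coe_finsetSum, LinearMap.sum_apply]
    exact Finset.sum_pos' (fun t _ => (g t).2.2 s (σ.gens_mem_cone hs)) ⟨s, hs, h⟩

end WeightVectors

/-! ### Real-valued homomorphisms on ordered groups. -/

section OrderedGroup

/-- Hölder's construction: L g is the supremum of the p/q with p • γ ≤ q • g. The group need not be
archimedean; elements infinitely small relative to γ are sent to 0. -/
theorem exists_monotone_real_hom {G : Type*} [AddCommGroup G] [LinearOrder G]
    [IsOrderedAddMonoid G] {γ : G} (hγ : 0 < γ) (hb : ∀ g : G, ∃ n : ℕ, g ≤ n • γ) :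
    ∃ L : G → ℝ, (∀ a b, L (a + b) = L a + L b) ∧ (∀ a, 0 ≤ a → 0 ≤ L a) ∧ L γ = 1 := by
  have hfl : ∀ g : G, ∃ k : ℤ, k • γ ≤ g ∧ g < (k + 1) • γ := by
    intro g
    obtain ⟨n, hn⟩ := hb g
    obtain ⟨n', hn'⟩ := hb (-g)
    obtain ⟨k, hk, hmax⟩ := Int.exists_greatest_of_bdd (P := fun k => k • γ ≤ g)
      ⟨n, fun z hz => by
        have : z • γ ≤ (n : ℤ) • γ := hz.trans (by simpa using hn)
        exact (zsmul_le_zsmul_iff_left hγ).mp this⟩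
      ⟨-n', by rw [neg_smul, natCast_zsmul]; exact neg_le.mp hn'⟩
    refine ⟨k, hk, ?_⟩
    by_contra! h
    exact absurd (hmax _ h) (by lia)
  choose fl h1 h2 using hfl
  have hlt : ∀ a b : ℤ, a • γ < b • γ → a < b := fun a b h => (zsmul_lt_zsmul_iff_left hγ).mp h
  -- an integer bound for `q • g` bounds the quotient
  let S : G → Set ℝ := fun g => {r | ∃ p : ℤ, ∃ q : ℕ, 0 < q ∧ p • γ ≤ q • g ∧ r = p / q}
  have hbd : ∀ g, ∀ r ∈ S g, ∀ p : ℤ, ∀ q : ℕ, 0 < q → q • g ≤ p • γ → r ≤ p / q := by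
    rintro g _ ⟨p', q', hq', hp', rfl⟩ p q hq hp
    rw [div_le_div_iff₀ (by positivity) (by positivity)]
    have : (p' * q) • γ ≤ (p * q') • γ := by
      calc (p' * q) • γ = q • (p' • γ) := by rw [mul_comm, mul_smul, natCast_zsmul]
        _ ≤ q • (q' • g) := nsmul_le_nsmul_right hp' q
        _ = q' • (q • g) := nsmul_left_comm _ _ _
        _ ≤ q' • (p • γ) := nsmul_le_nsmul_right hp q'
        _ = (p * q') • γ := by rw [mul_comm p, mul_smul, natCast_zsmul]
    exact_mod_cast (zsmul_le_zsmul_iff_left hγ).mp this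
  have hne : ∀ g, (S g).Nonempty := fun g => ⟨_, fl g, 1, one_pos, by simpa using h1 g, rfl⟩
  have hbdd : ∀ g, BddAbove (S g) := fun g =>
    ⟨_, fun r hr => hbd g r hr (fl g + 1) 1 one_pos (by simpa using (h2 g).le)⟩
  let L : G → ℝ := fun g => sSup (S g)
  have hle : ∀ g (p : ℤ) (q : ℕ), 0 < q → p • γ ≤ q • g → (p : ℝ) / q ≤ L g :=
    fun g p q hq h => le_csSup (hbdd g) ⟨p, q, hq, h, rfl⟩
  have hge : ∀ g (p : ℤ) (q : ℕ), 0 < q → q • g ≤ p • γ → L g ≤ (p : ℝ) / q :=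
    fun g p q hq h => csSup_le (hne g) fun r hr => hbd g r hr p q hq h
  refine ⟨L, fun a b => ?_, fun a ha => ?_, ?_⟩
  -- Bracketing n • a and n • b between consecutive multiples of γ gives both sides up to 2/n.
  · have key : ∀ n : ℕ, 0 < n → |L (a + b) - (L a + L b)| ≤ 2 / n := by
      intro n hn
      have hn' : (0 : ℝ) < n := by exact_mod_cast hn
      have ha1 := hle a _ n hn (h1 (n • a))
      have ha2 := hge a _ n hn (h2 (n • a)).le
      have hb1 := hle b _ n hn (h1 (n • b))
      have hb2 := hge b _ n hn (h2 (n • b)).le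
      have hc1 := hle (a + b) (fl (n • a) + fl (n • b)) n hn (by
        rw [add_smul, smul_add]; exact add_le_add (h1 _) (h1 _))
      have hc2 := hge (a + b) ((fl (n • a) + 1) + (fl (n • b) + 1)) n hn (by
        rw [add_smul, smul_add]; exact add_le_add (h2 _).le (h2 _).le)
      push_cast at *
      rw [add_div] at ha2 hb2 hc1 hc2
      rw [add_div, add_div] at hc2
      have h3 : (2 : ℝ) / n = 1 / n + 1 / n := by rw [← add_div]; norm_num
      rw [abs_le, h3]
      constructor <;> linarith
    have hz : |L (a + b) - (L a + L b)| ≤ 0 := by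
      refine ge_of_tendsto (tendsto_const_div_atTop_nhds_zero_nat 2) ?_
      filter_upwards [Filter.eventually_gt_atTop 0] with n hn using key n hn
    exact sub_eq_zero.mp (abs_eq_zero.mp (le_antisymm hz (abs_nonneg _)))
  · have := hle a 0 1 one_pos (by simpa using ha)
    simpa using this
  · refine le_antisymm ?_ ?_
    · have := hge γ 1 1 one_pos (by simp)
      simpa using this
    · have := hle γ 1 1 one_pos (by simp)
      simpa using this

end OrderedGroup

/-! ### Locally principal primes, symbolic squares and complete integral closedness. -/

section CommAlg

variable {R : Type*} [CommRing R]

/-- Krull's principal ideal theorem: P has height at most one. -/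
theorem eq_of_le_of_mem_minimalPrimes_span_singleton [IsDomain R] [IsNoetherianRing R] {x : R}
    {P Q : Ideal R} (hP : P ∈ (Ideal.span {x}).minimalPrimes) [Q.IsPrime] (hQP : Q ≤ P)
    (hQ : Q ≠ ⊥) : Q = P := by
  by_contra hne
  have := hP.isPrime
  have h1 := Ideal.height_le_one_of_isPrincipal_of_mem_minimalPrimes (Ideal.span {x}) P hP
  have h2 := Ideal.height_add_one_le_of_lt_of_isPrime (lt_of_le_of_ne hQP hne)
  have h3 : Q.height ≠ 0 := fun h => hQ (Ideal.height_eq_zero_iff_eq_bot.mp h)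
  have h4 : 1 ≤ Q.height := Order.one_le_iff_ne_zero.mpr h3
  have h5 : (1 : ℕ∞) + 1 ≤ 1 := (add_le_add_left h4 1).trans (h2.trans h1)
  exact absurd h5 (by decide)

/-- The prime ideal `P` becomes principal in the localization at `P`. -/
def IsLocallyPrincipal (P : Ideal R) : Prop := ∃ p ∈ P, ∃ u ∉ P, ∀ x ∈ P, p ∣ u * x

/-- `h` belongs to the second symbolic power of `P`. -/
def MemSymbolicSquare (h : R) (P : Ideal R) : Prop := ∃ u ∉ P, u * h ∈ P ^ 2

theorem MemSymbolicSquare.mem {h : R} {P : Ideal R} [P.IsPrime] (hh : MemSymbolicSquare h P) :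
    h ∈ P := by
  obtain ⟨u, hu, huh⟩ := hh
  exact (Ideal.IsPrime.mem_or_mem ‹_› (Ideal.pow_le_self two_ne_zero huh)).resolve_left hu

theorem MemSymbolicSquare.of_unit_mul {x h : R} {P : Ideal R} (hx : IsUnit x)
    (hh : MemSymbolicSquare (x * h) P) : MemSymbolicSquare h P := by
  obtain ⟨u, hu, huh⟩ := hh
  exact ⟨u * x, fun h => hu ((Ideal.mul_unit_mem_iff_mem P hx).mp h), by rwa [mul_assoc]⟩

theorem IsLocallyPrincipal.eq_of_le [IsDomain R] [IsNoetherianRing R] {P Q : Ideal R}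
    [P.IsPrime] (hP : IsLocallyPrincipal P) [Q.IsPrime] (hQP : Q ≤ P) (hQ : Q ≠ ⊥) : Q = P := by
  obtain ⟨p, hpP, u, hu, hdvd⟩ := hP
  refine eq_of_le_of_mem_minimalPrimes_span_singleton (x := p) ?_ hQP hQ
  refine ⟨⟨‹_›, (Ideal.span_singleton_le_iff_mem _).mpr hpP⟩, fun Q' hQ' hle x hx => ?_⟩
  have := hQ'.1
  have hp : p ∈ Q' := (Ideal.span_singleton_le_iff_mem _).mp hQ'.2
  exact (hQ'.1.mem_or_mem (Q'.mem_of_dvd (hdvd x hx) hp)).resolve_left fun h => hu (hle h)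

/-- Locally principal primes contain no smaller non-zero prime, so those through x are minimal over
(x). -/
theorem finite_isLocallyPrincipal_mem [IsDomain R] [IsNoetherianRing R] {x : R} (hx : x ≠ 0) :
    {P : Ideal R | P.IsPrime ∧ IsLocallyPrincipal P ∧ x ∈ P}.Finite := by
  refine (Ideal.finite_minimalPrimes_of_isNoetherianRing R (Ideal.span {x})).subset ?_
  rintro P ⟨hP, hloc, hxP⟩
  refine ⟨⟨hP, (Ideal.span_singleton_le_iff_mem _).mpr hxP⟩, fun Q hQ hle => ?_⟩
  have := hQ.1
  have hxQ := (Ideal.span_singleton_le_iff_mem _).mp hQ.2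
  exact (hloc.eq_of_le hle fun h => hx (by rwa [h] at hxQ)).ge

/-- In a local Noetherian domain all of whose non-zero primes contain `h`, the maximal ideal is the
radical of `h`. -/
theorem exists_pow_dvd_of_mem_maximalIdeal [IsDomain R] [IsNoetherianRing R] [IsLocalRing R]
    {h : R} (h0 : h ≠ 0) (hm : h ∈ IsLocalRing.maximalIdeal R)
    (hprime : ∀ Q : Ideal R, Q.IsPrime → Q ≠ ⊥ → h ∈ Q) {y : R}
    (hy : y ∈ IsLocalRing.maximalIdeal R) : ∃ k : ℕ, h ∣ y ^ k := by
  have hle : Ideal.span {h} ≤ IsLocalRing.maximalIdeal R :=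
    (Ideal.span_singleton_le_iff_mem _).mpr hm
  have hmin : IsLocalRing.maximalIdeal R ∈ (Ideal.span {h}).minimalPrimes := by
    -- Otherwise prime avoidance gives z in the maximal ideal outside all minimal primes of (h). A
    -- minimal prime of (z) contains h, hence equals a minimal prime of (h) by Krull, a
    -- contradiction.
    by_contra hcon
    have hfin := Ideal.finite_minimalPrimes_of_isNoetherianRing R (Ideal.span {h})
    have hnot : ¬ ((IsLocalRing.maximalIdeal R : Ideal R) : Set R) ⊆
        ⋃ q ∈ (Ideal.span {h}).minimalPrimes, (id q : Ideal R) := by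
      rw [Ideal.subset_union_prime_finite hfin (f := id) 0 0 fun q hq _ _ => hq.1.1]
      rintro ⟨q, hq, hqle⟩
      have : q = IsLocalRing.maximalIdeal R :=
        le_antisymm (IsLocalRing.le_maximalIdeal hq.1.1.ne_top) hqle
      exact hcon (this ▸ hq)
    obtain ⟨z, hz, hzn⟩ := Set.not_subset.mp hnot
    simp only [id, Set.mem_iUnion, not_exists] at hzn
    obtain ⟨q₀, hq₀, -⟩ := Ideal.exists_minimalPrimes_le hle
    have hz0 : z ≠ 0 := fun h => hzn q₀ hq₀ (h ▸ q₀.zero_mem)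
    obtain ⟨p, hp, -⟩ := Ideal.exists_minimalPrimes_le
      ((Ideal.span_singleton_le_iff_mem _).mpr hz)
    have hzp : z ∈ p := (Ideal.span_singleton_le_iff_mem _).mp hp.1.2
    have hhp : h ∈ p := hprime p hp.1.1 fun h => hz0 (by rwa [h] at hzp)
    have := hp.1.1
    obtain ⟨q, hq, hqp⟩ := Ideal.exists_minimalPrimes_le
      ((Ideal.span_singleton_le_iff_mem _).mpr hhp)
    have hhq : h ∈ q := (Ideal.span_singleton_le_iff_mem _).mp hq.1.2
    have := hq.1.1
    have hqp' := eq_of_le_of_mem_minimalPrimes_span_singleton hp hqp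
      fun h => h0 (by rwa [h] at hhq)
    exact hzn q hq (hqp' ▸ hzp)
  have hrad : y ∈ (Ideal.span {h}).radical := by
    rw [Ideal.radical_eq_sInf, Ideal.mem_sInf]
    rintro Q ⟨hQ, hQp⟩
    have hhQ : h ∈ Q := (Ideal.span_singleton_le_iff_mem _).mp hQ
    rwa [eq_of_le_of_mem_minimalPrimes_span_singleton hmin (IsLocalRing.le_maximalIdeal hQp.ne_top)
      fun h => h0 (by rwa [h] at hhQ)]
  obtain ⟨k, hk⟩ := hrad
  exact ⟨k, Ideal.mem_span_singleton.mp hk⟩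

theorem exists_pow_dvd_of_ne_zero [IsDomain R]
    {h : R} (hprime : ∀ Q : Ideal R, Q.IsPrime → Q ≠ ⊥ → h ∈ Q) {y : R}
    (hy : y ≠ 0) : ∃ k : ℕ, y ∣ h ^ k := by
  have hrad : h ∈ (Ideal.span {y}).radical := by
    rw [Ideal.radical_eq_sInf, Ideal.mem_sInf]
    rintro Q ⟨hQ, hQp⟩
    refine hprime Q hQp fun h0 => hy ?_
    have := (Ideal.span_singleton_le_iff_mem _).mp hQ
    rwa [h0] at this
  obtain ⟨k, hk⟩ := hrad
  exact ⟨k, Ideal.mem_span_singleton.mp hk⟩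

/-- I is the intersection of finitely many minimal primes; s is a product of elements taken from the
others and outside P. Thus I and P agree locally at P. -/
theorem exists_mul_mem_of_mem_minimalPrimes [IsNoetherianRing R] {I P : Ideal R}
    (hI : I.IsRadical) (hP : P ∈ I.minimalPrimes) : ∃ s ∉ P, ∀ x ∈ P, s * x ∈ I := by
  have hfin := Ideal.finite_minimalPrimes_of_isNoetherianRing R I
  have hex : ∀ Q ∈ I.minimalPrimes, Q ≠ P → ∃ s ∈ Q, s ∉ P := fun Q hQ hne => by
    by_contra! hcon
    exact hne (le_antisymm hcon (hP.2 hQ.1 hcon))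
  classical
  choose! g hgQ hgP using hex
  have hPp := hP.1.1
  refine ⟨∏ Q ∈ hfin.toFinset.erase P, g Q, fun h => ?_, fun x hx => ?_⟩
  · obtain ⟨Q, hQ, hgQP⟩ := (hPp.prod_mem_iff).mp h
    rw [Finset.mem_erase, Set.Finite.mem_toFinset] at hQ
    exact hgP Q hQ.2 hQ.1 hgQP
  · refine hI.radical.le ?_
    rw [← Ideal.sInf_minimalPrimes, Ideal.mem_sInf]
    intro Q hQ
    by_cases hQP : Q = P
    · rw [hQP]; exact P.mul_mem_left _ hx
    · refine Q.mul_mem_right _ ?_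
      exact Q.mem_of_dvd (Finset.dvd_prod_of_mem g (Finset.mem_erase.mpr
        ⟨hQP, hfin.mem_toFinset.mpr hQ⟩)) (hgQ Q hQ hQP)

/-- A radical ideal is not contained in the symbolic square of a non-zero locally principal prime
which does not contain a given multiplier. -/
theorem not_mul_le_sq [IsDomain R] [IsNoetherianRing R] {I P : Ideal R} (hI : I.IsRadical)
    (hI0 : I ≠ ⊥) [P.IsPrime] (hP : IsLocallyPrincipal P) {v : R} (hv : v ∉ P)
    (h : ∀ x ∈ I, v * x ∈ P ^ 2) : False := by
  have hIP : I ≤ P := fun x hx =>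
    (Ideal.IsPrime.mem_or_mem ‹_› (Ideal.pow_le_self two_ne_zero (h x hx))).resolve_left hv
  have hmin : P ∈ I.minimalPrimes := by
    refine ⟨⟨‹_›, hIP⟩, fun Q hQ hle => ?_⟩
    have := hQ.1
    exact (hP.eq_of_le hle fun h => hI0 (le_bot_iff.mp (h ▸ hQ.2))).ge
  obtain ⟨s, hs, hsI⟩ := exists_mul_mem_of_mem_minimalPrimes hI hmin
  obtain ⟨p, hpP, u, hu, hdvd⟩ := hP
  -- Locally at P the square P² is generated by p², with denominator u².
  have hsq : ∀ y ∈ P ^ 2, p ^ 2 ∣ u ^ 2 * y := by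
    intro y hy
    rw [pow_two] at hy
    refine Submodule.mul_induction_on hy (fun a ha b hb => ?_) fun a b ha hb => ?_
    · have := mul_dvd_mul (hdvd a ha) (hdvd b hb)
      convert this using 1 <;> ring
    · rw [mul_add]; exact dvd_add ha hb
  have hp0 : p ≠ 0 := by
    rintro rfl
    have : P = ⊥ := le_bot_iff.mp fun x hx => by
      have h1 := zero_dvd_iff.mp (hdvd x hx)
      have hu0 : u ≠ 0 := fun h => hu (h ▸ P.zero_mem)
      exact (mul_eq_zero.mp h1).resolve_left hu0
    exact hI0 (le_bot_iff.mp (this ▸ hIP))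
  have h1 := hsq _ (h _ (hsI p hpP))
  rw [pow_two p, show u ^ 2 * (v * (s * p)) = (u ^ 2 * (v * s)) * p by ring] at h1
  have h2 : p ∣ u ^ 2 * (v * s) := (mul_dvd_mul_iff_right hp0).mp h1
  have h3 := P.mem_of_dvd h2 hpP
  have hPp : P.IsPrime := ‹_›
  rcases hPp.mem_or_mem h3 with h | h
  · exact hu (hPp.mem_of_pow_mem 2 h)
  · exact (hPp.mem_or_mem h).elim hv hs

/-- `P` is the annihilator of the class of an element modulo `h`. -/
def IsColonPrime (h : R) (P : Ideal R) : Prop := P.IsPrime ∧ ∃ c, ∀ x, x ∈ P ↔ h ∣ c * x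

/-- These are the associated primes of R/(h): the annihilator of a non-zero class lies in one of
them. -/
theorem exists_isColonPrime [IsNoetherianRing R] {h y : R} (hy : ¬ h ∣ y) :
    ∃ P, IsColonPrime h P ∧ ∀ x, h ∣ y * x → x ∈ P := by
  have hdiv : ∀ (c x : R), x ∈ (⊥ : Submodule R (R ⧸ Ideal.span {h})).colon
      {Ideal.Quotient.mk (Ideal.span {h}) c} ↔ h ∣ c * x := fun c x => by
    rw [Submodule.mem_colon_singleton, Submodule.mem_bot, Algebra.smul_def,
      Ideal.Quotient.algebraMap_eq, ← map_mul, Ideal.Quotient.eq_zero_iff_mem,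
      Ideal.mem_span_singleton, mul_comm]
  obtain ⟨P, hP, hle⟩ := exists_le_isAssociatedPrime_of_isNoetherianRing R
    (Ideal.Quotient.mk (Ideal.span {h}) y) (by
      rwa [Ne, Ideal.Quotient.eq_zero_iff_mem, Ideal.mem_span_singleton])
  rw [isAssociatedPrime_iff] at hP
  obtain ⟨hPp, x, rfl⟩ := hP
  obtain ⟨c, rfl⟩ := Ideal.Quotient.mk_surjective x
  exact ⟨_, ⟨hPp, c, fun x => hdiv c x⟩, fun x hx => hle ((hdiv y x).mpr hx)⟩

/-- The divisibility form of complete integral closedness. -/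
def IsCompletelyNormal (R : Type*) [CommRing R] : Prop :=
  ∀ c h d : R, h ≠ 0 → d ≠ 0 → (∀ n : ℕ, h ^ n ∣ d * c ^ n) → h ∣ c

/-- If cP ⊆ hP, iteration shows that h ^ n divides h * c ^ n for all n, so h divides c and 1 ∈ P.
Hence (c/h)P contains an element u outside P. -/
theorem IsCompletelyNormal.colonPrime (hR : IsCompletelyNormal R) {h : R}
    (h0 : h ≠ 0) {P : Ideal R} (hP : P.IsPrime) {c : R} (hc : ∀ x, x ∈ P ↔ h ∣ c * x) :
    ∃ p ∈ P, ∃ u ∉ P, c * p = h * u := by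
  by_contra! hcon
  have key : ∀ n : ℕ, ∃ y ∈ P, h * c ^ n = h ^ n * y := by
    intro n
    induction n with
    | zero => exact ⟨h, (hc h).mpr (dvd_mul_left _ _), by ring⟩
    | succ n ih =>
      obtain ⟨y, hy, hyn⟩ := ih
      obtain ⟨u, hu⟩ := (hc y).mp hy
      refine ⟨u, by_contra fun hnu => hcon y hy u hnu hu, ?_⟩
      calc h * c ^ (n + 1) = h * c ^ n * c := by ring
        _ = h ^ n * (c * y) := by rw [hyn]; ring
        _ = h ^ (n + 1) * u := by rw [hu]; ring
  have h1 : h ∣ c := hR c h h h0 h0 fun n => by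
    obtain ⟨y, -, hy⟩ := key n
    exact ⟨y, hy⟩
  exact hP.ne_top ((Ideal.eq_top_iff_one P).mpr ((hc 1).mpr (by rwa [mul_one])))

theorem IsCompletelyNormal.dvd_of_colonPrime [IsDomain R] {h : R}
    (h0 : h ≠ 0) {P : Ideal R} {c : R} (hc : ∀ x, x ∈ P ↔ h ∣ c * x)
    {p u : R} (hpu : c * p = h * u) {x : R} (hx : x ∈ P) : p ∣ u * x := by
  obtain ⟨z, hz⟩ := (hc x).mp hx
  refine ⟨z, mul_left_cancel₀ h0 ?_⟩
  calc h * (u * x) = (c * p) * x := by rw [hpu]; ring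
    _ = p * (c * x) := by ring
    _ = h * (p * z) := by rw [hz]; ring

theorem IsCompletelyNormal.isLocallyPrincipal [IsDomain R] (hR : IsCompletelyNormal R) {h : R}
    (h0 : h ≠ 0) {P : Ideal R} (hP : IsColonPrime h P) : IsLocallyPrincipal P := by
  obtain ⟨hPp, c, hc⟩ := hP
  obtain ⟨p, hp, u, hu, hpu⟩ := hR.colonPrime h0 hPp hc
  exact ⟨p, hp, u, hu, fun x hx => IsCompletelyNormal.dvd_of_colonPrime h0 hc hpu hx⟩

/-- If x is nilpotent modulo h but not divisible by h, some associated prime P = (h : c) contains (h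
: x). Locally P = (p) with cp = hu, and h ∉ P^(2) means c ∉ P. Then x ∈ P gives cu ∈ (h : x) ⊆ P, a
contradiction. -/
theorem IsCompletelyNormal.isRadical_span_singleton [IsDomain R] [IsNoetherianRing R]
    (hR : IsCompletelyNormal R) {h : R} (h0 : h ≠ 0)
    (hh : ∀ P, IsColonPrime h P → ¬ MemSymbolicSquare h P) : (Ideal.span {h}).IsRadical := by
  rintro x ⟨n, hn⟩
  rw [Ideal.mem_span_singleton] at hn ⊢
  by_contra hx
  obtain ⟨P, hP, hxP⟩ := exists_isColonPrime hx
  have hbad := hh P hP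
  obtain ⟨hPp, c, hc⟩ := hP
  obtain ⟨p, hp, u, hu, hpu⟩ := hR.colonPrime h0 hPp hc
  have hcP : c ∉ P := fun hcP => hbad ⟨u, hu, by
    rw [mul_comm, ← hpu, pow_two]; exact Ideal.mul_mem_mul hcP hp⟩
  have hhP : h ∈ P := (hc h).mpr (dvd_mul_left _ _)
  have hx' : x ∈ P := hPp.mem_of_pow_mem n (P.mem_of_dvd hn hhP)
  obtain ⟨z, hz⟩ := IsCompletelyNormal.dvd_of_colonPrime h0 hc hpu hx'
  have h1 : h ∣ x * (c * u) := ⟨u * z, by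
    calc x * (c * u) = c * (u * x) := by ring
      _ = (c * p) * z := by rw [hz]; ring
      _ = h * (u * z) := by rw [hpu]; ring⟩
  exact (hPp.mem_or_mem (hxP _ h1)).elim hcP hu

theorem isColonPrime_of_mem_minimalPrimes [IsNoetherianRing R] {h : R} {P : Ideal R}
    (hrad : (Ideal.span {h}).IsRadical) (hP : P ∈ (Ideal.span {h}).minimalPrimes) :
    IsColonPrime h P := by
  obtain ⟨s, hs, hsI⟩ := exists_mul_mem_of_mem_minimalPrimes hrad hP
  refine ⟨hP.1.1, s, fun x => ⟨fun hx => Ideal.mem_span_singleton.mp (hsI x hx), fun hx => ?_⟩⟩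
  exact (hP.1.1.mem_or_mem (hP.1.2 (Ideal.mem_span_singleton.mpr hx))).resolve_left hs

end CommAlg

/-! ### A Bertini theorem for symbolic squares in arbitrary characteristic. -/

section Bertini

variable {K : Type*} [Field K] {R : Type*} [CommRing R] [Algebra K R]

theorem smul_mem_of_add_smul_mem {J : Ideal R} {f g : R} {a b : K} (hab : a ≠ b)
    (ha : f + a • g ∈ J) (hb : f + b • g ∈ J) : f ∈ J ∧ g ∈ J := by
  have h1 : (a - b) • g ∈ J := by
    have := J.sub_mem ha hb
    rwa [add_sub_add_left_eq_sub, ← sub_smul] at this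
  have hg : g ∈ J := by
    have := Submodule.smul_of_tower_mem J (a - b)⁻¹ h1
    rwa [smul_smul, inv_mul_cancel₀ (sub_ne_zero.mpr hab), one_smul] at this
  refine ⟨?_, hg⟩
  have := J.sub_mem ha (Submodule.smul_of_tower_mem J a hg)
  rwa [add_sub_cancel_right] at this

/-- Two such values of κ would, over a common denominator, place both f and g in the symbolic
square. -/
theorem subsingleton_memSymbolicSquare (f g : R) (P : Ideal R) [P.IsPrime] :
    {κ : K | MemSymbolicSquare (f + κ • g) P ∧
      ¬ (MemSymbolicSquare f P ∧ MemSymbolicSquare g P)}.Subsingleton := by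
  rintro a ⟨⟨u, hu, hua⟩, hna⟩ b ⟨⟨v, hv, hvb⟩, -⟩
  by_contra hab
  have hPp : P.IsPrime := ‹_›
  have huv : u * v ∉ P := fun h => (hPp.mem_or_mem h).elim hu hv
  have h1 : u * v * f + a • (u * v * g) ∈ P ^ 2 := by
    have := (P ^ 2).mul_mem_left v hua
    convert this using 1
    simp only [Algebra.smul_def]; ring
  have h2 : u * v * f + b • (u * v * g) ∈ P ^ 2 := by
    have := (P ^ 2).mul_mem_left u hvb
    convert this using 1
    simp only [Algebra.smul_def]; ring
  obtain ⟨h3, h4⟩ := smul_mem_of_add_smul_mem hab h1 h2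
  exact hna ⟨⟨_, huv, h3⟩, ⟨_, huv, h4⟩⟩

theorem derivation_mem_of_memSymbolicSquare (D : Derivation K R R) {h : R} {P : Ideal R}
    [P.IsPrime] (hh : MemSymbolicSquare h P) : D h ∈ P := by
  have hhP := hh.mem
  obtain ⟨u, hu, huh⟩ := hh
  have hD : ∀ y ∈ P ^ 2, D y ∈ P := by
    intro y hy
    rw [pow_two] at hy
    refine Submodule.mul_induction_on hy (fun a ha b hb => ?_) fun a b ha hb => ?_
    · rw [Derivation.leibniz]
      exact P.add_mem (P.mul_mem_right _ ha) (P.mul_mem_right _ hb)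
    · rw [map_add]; exact P.add_mem ha hb
  have h1 := hD _ huh
  rw [Derivation.leibniz] at h1
  have h2 : u • D h ∈ P := (P.add_mem_iff_left (P.mul_mem_right _ hhP)).mp h1
  exact (Ideal.IsPrime.mem_or_mem ‹_› h2).resolve_left hu

/-- If h = f + κg is in the symbolic square of P, then h and Dh are in P, hence so is g·Dh - h·Dg =
g·Df - f·Dg, which does not depend on κ. This Wronskian is non-zero, so only finitely many P matter,
and each excludes at most one κ. The same count handles E. -/
theorem exists_generic_add_smul [Infinite K] [IsDomain R] [IsNoetherianRing R]
    (D : Derivation K R R) {f g : R} (hf : f ≠ 0) (hfg : g * D f ≠ f * D g)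
    {E : Set (Ideal R)} (hE : E.Finite) :
    ∃ κ : K, f + κ • g ≠ 0 ∧
      (∀ P : Ideal R, P.IsPrime → IsLocallyPrincipal P → MemSymbolicSquare (f + κ • g) P →
        MemSymbolicSquare f P ∧ MemSymbolicSquare g P) ∧
      ∀ P ∈ E, f + κ • g ∈ P → f ∈ P ∧ g ∈ P := by
  have hfin := finite_isLocallyPrincipal_mem (sub_ne_zero.mpr hfg)
  set T := {P : Ideal R | P.IsPrime ∧ IsLocallyPrincipal P ∧ g * D f - f * D g ∈ P} with hT
  let B0 : Set K := {κ | f + κ • g ∈ (⊥ : Ideal R) ∧ ¬ (f ∈ (⊥ : Ideal R) ∧ g ∈ (⊥ : Ideal R))}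
  let B1 : Set K := ⋃ P ∈ T, {κ : K | MemSymbolicSquare (f + κ • g) P ∧
      ¬ (MemSymbolicSquare f P ∧ MemSymbolicSquare g P)}
  let B2 : Set K := ⋃ P ∈ E, {κ : K | f + κ • g ∈ P ∧ ¬ (f ∈ P ∧ g ∈ P)}
  have hsub : ∀ J : Ideal R, {κ : K | f + κ • g ∈ J ∧ ¬ (f ∈ J ∧ g ∈ J)}.Subsingleton := by
    rintro J a ⟨ha, hna⟩ b ⟨hb, -⟩
    by_contra hab
    exact hna (smul_mem_of_add_smul_mem hab ha hb)
  have hB : (B0 ∪ B1 ∪ B2).Finite := by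
    refine ((hsub ⊥).finite.union (hfin.biUnion fun P hP => ?_)).union
      (hE.biUnion fun P _ => (hsub P).finite)
    have := hP.1
    exact (subsingleton_memSymbolicSquare f g P).finite
  obtain ⟨κ, hκ⟩ := hB.exists_notMem
  simp only [Set.mem_union, not_or] at hκ
  obtain ⟨⟨hκ0, hκ1⟩, hκ2⟩ := hκ
  refine ⟨κ, fun h => hκ0 ⟨h, fun h' => hf h'.1⟩, fun P hP hloc hbad => ?_, fun P hPE hmem => ?_⟩
  · by_contra hcon
    refine hκ1 (Set.mem_iUnion₂.mpr ⟨P, ⟨hP, hloc, ?_⟩, hbad, hcon⟩)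
    have h1 := derivation_mem_of_memSymbolicSquare D hbad
    have h2 := hbad.mem
    have h3 := P.sub_mem (P.mul_mem_left g h1) (P.mul_mem_right (D g) h2)
    convert h3 using 1
    rw [map_add, Derivation.map_smul]
    simp only [Algebra.smul_def]
    ring
  · by_contra hcon
    exact hκ2 (Set.mem_iUnion₂.mpr ⟨P, hPE, hmem, hcon⟩)

/-- A Bertini type statement: a generic perturbation `f + g` of `f` by elements `g` of an ideal lies
in the symbolic square of a locally principal prime only if this holds for `f` and for the
generators of the ideal. -/
theorem exists_generic_add [Infinite K] [IsDomain R] [IsNoetherianRing R]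
    (D : Derivation K R R) {e : R} (he : IsUnit e) (hDe : D e ≠ 0) {f : R} (hf : f ≠ 0)
    {E : Set (Ideal R)} (hE : E.Finite) (G : Finset R) :
    ∃ g ∈ Ideal.span (G : Set R), f + g ≠ 0 ∧
      (∀ P : Ideal R, P.IsPrime → IsLocallyPrincipal P → MemSymbolicSquare (f + g) P →
        ∀ x ∈ G, MemSymbolicSquare x P) ∧
      ∀ P ∈ E, f + g ∈ P → f ∈ P ∧ ∀ x ∈ G, x ∈ P := by
  classical
  induction G using Finset.induction_on with
  | empty => exact ⟨0, zero_mem _, by simpa using hf, by simp, by simp⟩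
  | insert g₀ G _ ih =>
    obtain ⟨g, hg, hg0, hbad, hEg⟩ := ih
    have hspan : Ideal.span (G : Set R) ≤ Ideal.span ((insert g₀ G : Finset R) : Set R) :=
      Ideal.span_mono (by simp)
    have hg₀ : g₀ ∈ Ideal.span ((insert g₀ G : Finset R) : Set R) :=
      Ideal.subset_span (by simp)
    by_cases h0 : g₀ = 0
    · subst h0
      refine ⟨g, hspan hg, hg0, fun P hP hloc hb x hx => ?_, fun P hPE hmem => ?_⟩
      · rcases Finset.mem_insert.mp hx with rfl | hx
        · exact ⟨1, (Ideal.ne_top_iff_one P).mp hP.ne_top, by simp⟩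
        · exact hbad P hP hloc hb x hx
      · refine ⟨(hEg P hPE hmem).1, fun x hx => ?_⟩
        rcases Finset.mem_insert.mp hx with rfl | hx
        · exact P.zero_mem
        · exact (hEg P hPE hmem).2 x hx
    -- If the Wronskian with g₀ vanishes, the one with e * g₀ is -(f + g) * g₀ * D e ≠ 0; the unit e
    -- does not affect membership in ideals.
    · obtain ⟨x, hx, hW⟩ : ∃ x, IsUnit x ∧ (x * g₀) * D (f + g) ≠ (f + g) * D (x * g₀) := by
        by_cases h1 : (1 * g₀) * D (f + g) = (f + g) * D (1 * g₀)
        · refine ⟨e, he, fun h2 => ?_⟩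
          rw [one_mul] at h1
          have h3 : (f + g) * g₀ * D e = 0 := by
            rw [Derivation.leibniz, smul_eq_mul, smul_eq_mul] at h2
            linear_combination e * h1 - h2
          exact mul_ne_zero (mul_ne_zero hg0 h0) hDe h3
        · exact ⟨1, isUnit_one, h1⟩
      obtain ⟨κ, hκ0, hκ1, hκ2⟩ := exists_generic_add_smul D hg0 hW hE
      refine ⟨g + κ • (x * g₀), ?_, by rwa [← add_assoc], ?_, ?_⟩
      · exact add_mem (hspan hg) (Submodule.smul_of_tower_mem _ κ (Ideal.mul_mem_left _ x hg₀))
      · intro P hP hloc hb y hy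
        rw [← add_assoc] at hb
        obtain ⟨h1, h2⟩ := hκ1 P hP hloc hb
        rcases Finset.mem_insert.mp hy with rfl | hy
        · exact h2.of_unit_mul hx
        · exact hbad P hP hloc h1 y hy
      · intro P hPE hmem
        rw [← add_assoc] at hmem
        obtain ⟨h1, h2⟩ := hκ2 P hPE hmem
        obtain ⟨h3, h4⟩ := hEg P hPE h1
        refine ⟨h3, fun y hy => ?_⟩
        rcases Finset.mem_insert.mp hy with rfl | hy
        · exact (Ideal.unit_mul_mem_iff_mem P hx).mp h2
        · exact h4 y hy

end Bertini

/-! ### The ring K[[Γ]]: leading exponents, division, normality, face primes and derivations. -/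

section SeriesRing

variable {V : Type*} [NormedAddCommGroup V] [NormedSpace ℝ V] {N : Submodule ℤ V}

variable {σ : WeightCone N}

instance : AddCommMonoid (Exps σ) := AddSubmonoid.toAddCommMonoid _

/-- The finitely many pairs of exponents with a given sum. -/
def Exps.antidiag (m : Exps σ) : Finset (Exps σ × Exps σ) :=
  Finset.antidiagonal (Exps.isPWO Set.univ) (Exps.isPWO Set.univ) m

theorem Exps.mem_antidiag {m : Exps σ} {p : Exps σ × Exps σ} :
    p ∈ m.antidiag ↔ p.1 + p.2 = m := by
  simp [Exps.antidiag, Finset.mem_antidiagonal]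

theorem Exps.exists_nat (m : Exps σ) {s : V} (hs : s ∈ σ.gens) : ∃ k : ℕ, m.1 s = k := by
  obtain ⟨k, hk⟩ := m.2.1 s (σ.gens_mem_lattice hs)
  have h0 : (0 : ℝ) ≤ k := hk ▸ m.2.2 s (σ.gens_mem_cone hs)
  lift k to ℕ using (by exact_mod_cast h0)
  exact ⟨k, by simpa using hk⟩

theorem Exps.le_of_gens {a b : Exps σ} (h : ∀ s ∈ σ.gens, a.1 s ≤ b.1 s) : a ≤ b := by
  intro w hw
  have := σ.nonneg_of_gens (m := b.1 - a.1) (fun s hs => by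
    rw [LinearMap.sub_apply]; exact sub_nonneg.mpr (h s hs)) hw
  rw [LinearMap.sub_apply] at this
  exact sub_nonneg.mp this

/-- The coordinates of an exponent on the generators of the cone, ordered lexicographically. -/
def lexKey (m : Exps σ) : Lex (Fin σ.gens.card → ℕ) :=
  toLex fun i => (m.exists_nat (σ.gens.equivFin.symm i).2).choose

theorem lexKey_apply (m : Exps σ) (i : Fin σ.gens.card) :
    ((ofLex (lexKey m) i : ℕ) : ℝ) = m.1 (σ.gens.equivFin.symm i : V) :=
  (m.exists_nat (σ.gens.equivFin.symm i).2).choose_spec.symm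

theorem lexKey_add (a b : Exps σ) : lexKey (a + b) = lexKey a + lexKey b := by
  refine ofLex.injective (funext fun i => ?_)
  have h : ((ofLex (lexKey (a + b)) i : ℕ) : ℝ)
      = ((ofLex (lexKey a) i + ofLex (lexKey b) i : ℕ) : ℝ) := by
    rw [Nat.cast_add, lexKey_apply, lexKey_apply, lexKey_apply]; rfl
  exact_mod_cast h

theorem lexKey_injective : Function.Injective (lexKey (σ := σ)) := by
  intro a b h
  have key : ∀ s ∈ σ.gens, a.1 s = b.1 s := fun s hs => by
    have h1 := lexKey_apply a (σ.gens.equivFin ⟨s, hs⟩)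
    have h2 := lexKey_apply b (σ.gens.equivFin ⟨s, hs⟩)
    rw [Equiv.symm_apply_apply] at h1 h2
    rw [← h1, ← h2, h]
  exact le_antisymm (Exps.le_of_gens fun s hs => (key s hs).le)
    (Exps.le_of_gens fun s hs => (key s hs).ge)

theorem lexKey_zero_le (m : Exps σ) : lexKey 0 ≤ lexKey m := by
  refine Pi.toLex_monotone fun i => ?_
  have h := lexKey_apply (0 : Exps σ) i
  have h0 : ofLex (lexKey (0 : Exps σ)) i = 0 := by
    have : ((ofLex (lexKey (0 : Exps σ)) i : ℕ) : ℝ) = 0 := by rw [h]; rfl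
    exact_mod_cast this
  exact h0.le.trans (Nat.zero_le _)

/-- With additivity and injectivity this makes `lexKey` a monomial order: non-zero series have a
unique smallest exponent, and these add under multiplication. -/
theorem wellFounded_lexKey : WellFounded fun a b : Exps σ => lexKey a < lexKey b :=
  InvImage.wf lexKey wellFounded_lt

variable {K : Type*} [Field K]

instance : CommRing (PSeries K σ) := HahnSeries.instCommRing

instance : Semiring (PSeries K σ) := HahnSeries.instSemiring

instance PSeries.instAlgebra : Algebra K (PSeries K σ) := HahnSeries.instAlgebra

instance : Module K (PSeries K σ) := PSeries.instAlgebra.toModule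

theorem PSeries.coeff_mul_antidiag (f g : PSeries K σ) (m : Exps σ) :
    (f * g).coeff m = ∑ p ∈ m.antidiag, f.coeff p.1 * g.coeff p.2 := by
  rw [HahnSeries.coeff_mul_left' (Exps.isPWO Set.univ) (Set.subset_univ _)]
  refine Finset.sum_subset (fun p hp => ?_) fun p hp hnot => ?_
  · rw [Finset.mem_antidiagonal] at hp
    exact Exps.mem_antidiag.mpr hp.2.2
  · by_contra hne
    refine hnot ?_
    rw [Finset.mem_antidiagonal]
    exact ⟨trivial, right_ne_zero_of_mul hne, Exps.mem_antidiag.mp hp⟩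

@[simp]
theorem PSeries.coeff_ofCoeff (c : Exps σ → K) (m : Exps σ) : (PSeries.ofCoeff c).coeff m = c m :=
  rfl

theorem coeff_chi_mul_add (a b : Exps σ) (f : PSeries K σ) :
    (chi K a * f).coeff (a + b) = f.coeff b := by
  rw [chi, add_comm, HahnSeries.coeff_single_mul_add, one_mul]

theorem coeff_chi_mul_of_not_le {a m : Exps σ} (h : ¬ a ≤ m) (f : PSeries K σ) :
    (chi K a * f).coeff m = 0 := by
  rw [PSeries.coeff_mul_antidiag]
  refine Finset.sum_eq_zero fun p hp => ?_
  rw [Exps.mem_antidiag] at hp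
  have : p.1 ≠ a := fun h1 => h (Exps.le_iff_exists_add.mpr ⟨p.2, by rw [← h1, hp]⟩)
  rw [chi, HahnSeries.coeff_single_of_ne this, zero_mul]

theorem chi_add (a b : Exps σ) : chi K (a + b) = chi K a * chi K b := by
  simp [chi]

theorem chi_zero : chi K (0 : Exps σ) = 1 := rfl

theorem chi_ne_zero (a : Exps σ) : chi K a ≠ 0 := by
  simp [chi]

theorem chi_nsmul (n : ℕ) (a : Exps σ) : chi K (n • a) = chi K a ^ n := by
  rw [chi, chi, HahnSeries.single_pow, one_pow]

theorem mem_support_chi_mul {a m : Exps σ} {f : PSeries K σ} (h : m ∈ (chi K a * f).support) :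
    ∃ b ∈ f.support, m = a + b := by
  by_cases hle : a ≤ m
  · obtain ⟨b, rfl⟩ := Exps.le_iff_exists_add.mp hle
    exact ⟨b, by rwa [HahnSeries.mem_support, coeff_chi_mul_add] at h, rfl⟩
  · exact absurd (coeff_chi_mul_of_not_le hle f) h

/-- `m` is the lexicographically smallest exponent of `f`. -/
def IsLead (f : PSeries K σ) (m : Exps σ) : Prop :=
  m ∈ f.support ∧ ∀ m' ∈ f.support, lexKey m ≤ lexKey m'

theorem exists_isLead {f : PSeries K σ} (hf : f ≠ 0) : ∃ m, IsLead f m := by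
  obtain ⟨m, hm, hmin⟩ := wellFounded_lexKey.has_min f.support
    (HahnSeries.support_nonempty_iff.mpr hf)
  exact ⟨m, hm, fun m' hm' => not_lt.mp (hmin m' hm')⟩

theorem IsLead.ne_zero {f : PSeries K σ} {m : Exps σ} (h : IsLead f m) : f ≠ 0 :=
  HahnSeries.ne_zero_of_coeff_ne_zero h.1

theorem IsLead.unique {f : PSeries K σ} {a b : Exps σ} (ha : IsLead f a) (hb : IsLead f b) :
    a = b :=
  lexKey_injective (le_antisymm (ha.2 b hb.1) (hb.2 a ha.1))

/-- A product of two series has a non-zero coefficient at the sum of the lexicographically smallest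
exponents which lie on a given face of the dual cone. -/
theorem coeff_mul_add_of_min {f g : PSeries K σ} {u : V} (hu : u ∈ σ.cone) {a b : Exps σ}
    (hau : a.1 u = 0) (hbu : b.1 u = 0)
    (ha : ∀ m ∈ f.support, m.1 u = 0 → lexKey a ≤ lexKey m)
    (hb : ∀ m ∈ g.support, m.1 u = 0 → lexKey b ≤ lexKey m) :
    (f * g).coeff (a + b) = f.coeff a * g.coeff b := by
  rw [PSeries.coeff_mul_antidiag, Finset.sum_eq_single (a, b)]
  · rintro ⟨x, y⟩ hp hne
    rw [Exps.mem_antidiag] at hp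
    by_contra hxy
    have hx := left_ne_zero_of_mul hxy
    have hy := right_ne_zero_of_mul hxy
    have hsum : x.1 u + y.1 u = 0 := by
      have := congrArg (fun m : Exps σ => m.1 u) hp
      change x.1 u + y.1 u = a.1 u + b.1 u at this
      rw [this, hau, hbu, add_zero]
    have hx0 := x.2.2 u hu
    have hy0 := y.2.2 u hu
    have h1 := ha x hx (by linarith)
    have h2 := hb y hy (by linarith)
    have h3 : lexKey x + lexKey y = lexKey a + lexKey b := by
      rw [← lexKey_add, ← lexKey_add]; exact congrArg _ hp
    have h4 : lexKey a = lexKey x := by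
      refine le_antisymm h1 (not_lt.mp fun hlt => ?_)
      have h5 : lexKey a + lexKey b < lexKey x + lexKey y := add_lt_add_of_lt_of_le hlt h2
      rw [h3] at h5
      exact lt_irrefl _ h5
    have h5 : a = x := lexKey_injective h4
    have h6 : b = y := by rw [← h5] at hp; exact (add_left_cancel hp).symm
    exact hne (by rw [h5, h6])
  · intro h
    exact absurd (Exps.mem_antidiag.mpr (rfl : a + b = a + b)) h

theorem IsLead.mul {f g : PSeries K σ} {a b : Exps σ} (ha : IsLead f a) (hb : IsLead g b) :
    IsLead (f * g) (a + b) := by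
  refine ⟨?_, fun m hm => ?_⟩
  · rw [HahnSeries.mem_support, coeff_mul_add_of_min σ.cone.zero_mem (map_zero _) (map_zero _)
      (fun m hm _ => ha.2 m hm) fun m hm _ => hb.2 m hm]
    exact mul_ne_zero ha.1 hb.1
  · obtain ⟨x, hx, y, hy, rfl⟩ := Set.mem_add.mp (HahnSeries.support_mul_subset hm)
    rw [lexKey_add, lexKey_add]
    exact add_le_add (ha.2 x hx) (hb.2 y hy)

theorem isLead_one : IsLead (1 : PSeries K σ) 0 :=
  ⟨by simp, fun m _ => lexKey_zero_le m⟩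

theorem IsLead.pow {f : PSeries K σ} {a : Exps σ} (ha : IsLead f a) (n : ℕ) :
    IsLead (f ^ n) (n • a) := by
  induction n with
  | zero => simpa using isLead_one
  | succ n ih => rw [pow_succ, succ_nsmul]; exact ih.mul ha

instance : NoZeroDivisors (PSeries K σ) where
  eq_zero_or_eq_zero_of_mul_eq_zero {f g} h := by
    by_contra! hne
    obtain ⟨a, ha⟩ := exists_isLead hne.1
    obtain ⟨b, hb⟩ := exists_isLead hne.2
    exact (ha.mul hb).ne_zero h

instance : IsDomain (PSeries K σ) := NoZeroDivisors.to_isDomain _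

/-- **Division with respect to leading exponents.** -/
theorem mem_span_of_isLead {ι : Type*} [Finite ι] {I : Ideal (PSeries K σ)}
    {g : ι → PSeries K σ} (hgI : ∀ i, g i ∈ I) {l : ι → Exps σ} (hl : ∀ i, IsLead (g i) (l i))
    (hI : ∀ f ∈ I, ∀ m, IsLead f m → ∃ i, l i ≤ m) {f : PSeries K σ} (hf : f ∈ I) :
    f ∈ Ideal.span (Set.range g) := by
  classical
  have := Fintype.ofFinite ι
  let sel : Exps σ → Option ι := fun m => if h : ∃ i, l i ≤ m then some h.choose else none
  have hsel : ∀ m i, sel m = some i → l i ≤ m := by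
    intro m i h
    by_cases hex : ∃ i, l i ≤ m
    · simp only [sel, dif_pos hex, Option.some.injEq] at h
      exact h ▸ hex.choose_spec
    · simp [sel, dif_neg hex] at h
  have hsel' : ∀ m, (∃ i, l i ≤ m) → ∃ i, sel m = some i := fun m hex =>
    ⟨hex.choose, by simp only [sel, dif_pos hex]⟩
  let lc : Exps σ → K := fun m => (sel m).elim 0 fun i => ((g i).coeff (l i))⁻¹
  -- Each m above some l i is assigned to one index by `sel`. Its quotient coefficient b m is solved
  -- from the equation at m, where the leading term of the selected g i contributes b m times its
  -- leading coefficient and all other terms involve earlier b.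
  let step : (m : Exps σ) → ((m' : Exps σ) → lexKey m' < lexKey m → K) → K := fun m rec =>
    (f.coeff m - ∑ i, ∑ p ∈ m.antidiag, if h : lexKey (p.1 + l i) < lexKey m then
      (if sel (p.1 + l i) = some i then rec _ h else 0) * (g i).coeff p.2 else 0) * lc m
  let b : Exps σ → K := wellFounded_lexKey.fix (C := fun _ => K) step
  have hb : ∀ m, b m = (f.coeff m - ∑ i, ∑ p ∈ m.antidiag,
      if lexKey (p.1 + l i) < lexKey m then
        (if sel (p.1 + l i) = some i then b (p.1 + l i) else 0) * (g i).coeff p.2 else 0)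
        * lc m := by
    intro m
    have h1 : b m = step m fun m' _ => b m' := wellFounded_lexKey.fix_eq _ _
    rw [h1]
    simp only [step, dite_eq_ite]
  let G : ι → PSeries K σ := fun i =>
    PSeries.ofCoeff fun x => if sel (x + l i) = some i then b (x + l i) else 0
  have key : ∀ m j, sel m = some j → (∑ i, G i * g i).coeff m = f.coeff m := by
    intro m j hj
    obtain ⟨c, hc⟩ := Exps.le_iff_exists_add.mp (hsel m j hj)
    have hcoef : (g j).coeff (l j) ≠ 0 := (hl j).1
    have hbm := hb m
    have hlc : lc m = ((g j).coeff (l j))⁻¹ := by simp only [lc, hj, Option.elim_some]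
    rw [hlc, eq_mul_inv_iff_mul_eq₀ hcoef, eq_sub_iff_add_eq] at hbm
    rw [← hbm, HahnSeries.coeff_sum]
    have hsingle : b m * (g j).coeff (l j)
        = ∑ i, ∑ p ∈ m.antidiag, if i = j ∧ p.2 = l j then b m * (g j).coeff (l j) else 0 := by
      rw [Finset.sum_eq_single j, Finset.sum_eq_single (c, l j)]
      · simp
      · rintro ⟨x, y⟩ hp hne
        rw [Exps.mem_antidiag] at hp
        refine if_neg fun h => hne ?_
        have h2 : y = l j := h.2
        subst h2
        have h3 : l j + x = l j + c := by rw [← hc, ← hp, add_comm]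
        rw [add_left_cancel h3]
      · intro h
        exact absurd (Exps.mem_antidiag.mpr (by rw [hc, add_comm])) h
      · intro i _ hi
        exact Finset.sum_eq_zero fun p _ => if_neg fun h => hi h.1
      · simp
    rw [hsingle, ← Finset.sum_add_distrib]
    refine Finset.sum_congr rfl fun i _ => ?_
    rw [PSeries.coeff_mul_antidiag, ← Finset.sum_add_distrib]
    refine Finset.sum_congr rfl fun p hp => ?_
    rw [Exps.mem_antidiag] at hp
    simp only [G, PSeries.coeff_ofCoeff]
    have hkey : lexKey p.1 + lexKey p.2 = lexKey m := by rw [← lexKey_add, hp]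
    by_cases hlt : lexKey (p.1 + l i) < lexKey m
    · rw [if_pos hlt, if_neg (c := i = j ∧ p.2 = l j), zero_add]
      rintro ⟨rfl, h⟩
      rw [← h, hp] at hlt
      exact lt_irrefl _ hlt
    · rw [if_neg hlt, add_zero]
      by_cases hg0 : (g i).coeff p.2 = 0
      · rw [hg0, mul_zero, if_neg]
        rintro ⟨rfl, h⟩
        exact hcoef (h ▸ hg0)
      · have h1 : lexKey (l i) ≤ lexKey p.2 := (hl i).2 _ hg0
        have h2 : p.2 = l i := by
          refine lexKey_injective (le_antisymm ?_ h1)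
          rw [lexKey_add, ← hkey, add_lt_add_iff_left] at hlt
          exact not_lt.mp hlt
        have h3 : p.1 + l i = m := by rw [← h2, hp]
        rw [h3, hj]
        by_cases hij : i = j
        · subst hij
          rw [if_pos rfl, if_pos ⟨rfl, h2⟩, h2]
        · rw [if_neg fun h => hij (Option.some.inj h).symm, zero_mul, if_neg fun h => hij h.1]
  have hGI : ∑ i, G i * g i ∈ Ideal.span (Set.range g) :=
    Ideal.sum_mem _ fun i _ => Ideal.mul_mem_left _ _ (Ideal.subset_span ⟨i, rfl⟩)
  have hGI' : ∑ i, G i * g i ∈ I := Ideal.sum_mem _ fun i _ => I.mul_mem_left _ (hgI i)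
  -- The remainder lies in I, so its leading exponent would be above some l i, where its coefficient
  -- vanishes by construction.
  have hzero : f - ∑ i, G i * g i = 0 := by
    by_contra hne
    obtain ⟨m, hm⟩ := exists_isLead hne
    obtain ⟨j, hj⟩ := hsel' m (hI _ (I.sub_mem hf hGI') m hm)
    refine hm.1 ?_
    rw [HahnSeries.coeff_sub, key m j hj, sub_self]
  rw [sub_eq_zero.mp hzero]
  exact hGI

/-- The leading exponents of I have finitely many minimal elements, and by division the series
realizing them generate I. -/
instance : IsNoetherianRing (PSeries K σ) := by
  rw [isNoetherianRing_iff_ideal_fg]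
  intro I
  obtain ⟨T, hT, hle⟩ := Exps.exists_finset_le {m : Exps σ | ∃ f ∈ I, IsLead f m}
  have hT' : ∀ t ∈ T, ∃ f ∈ I, IsLead f t := fun t ht => hT ht
  choose! g hgI hg using hT'
  have hspan : I = Ideal.span (Set.range fun t : T => g t) := by
    refine le_antisymm (fun f hf => ?_) ?_
    · refine mem_span_of_isLead (fun t : T => hgI t.1 t.2) (fun t : T => hg t.1 t.2) (fun f hf m hm => ?_) hf
      obtain ⟨t, ht, htm⟩ := hle m ⟨f, hf, hm⟩
      exact ⟨⟨t, ht⟩, htm⟩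
    · rw [Ideal.span_le]
      rintro _ ⟨t, rfl⟩
      exact hgI t.1 t.2
  rw [hspan]
  exact Submodule.fg_span (Set.finite_range _)

theorem dvd_of_isLead_le {f h : PSeries K σ}
    (hle : ∀ f' ∈ Ideal.span {f, h}, ∀ m l, IsLead f' m → IsLead h l → l ≤ m) (hh : h ≠ 0) :
    h ∣ f := by
  obtain ⟨l, hl⟩ := exists_isLead hh
  have := mem_span_of_isLead (ι := Unit) (I := Ideal.span {f, h}) (g := fun _ => h)
    (fun _ => Ideal.subset_span (by simp)) (l := fun _ => l) (fun _ => hl)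
    (fun f' hf' m hm => ⟨(), hle f' hf' m l hm hl⟩) (Ideal.subset_span (by simp : f ∈ _))
  rwa [Set.range_const, Ideal.mem_span_singleton] at this

theorem PSeries.isUnit_of_coeff_zero_ne {f : PSeries K σ} (hf : f.coeff 0 ≠ 0) : IsUnit f := by
  refine isUnit_of_dvd_one (dvd_of_isLead_le (fun f' _ m l _ hl => ?_)
    (HahnSeries.ne_zero_of_coeff_ne_zero hf))
  have : IsLead f 0 := ⟨hf, fun m _ => lexKey_zero_le m⟩
  rw [hl.unique this]
  exact m.zero_le

/-- By the binomial theorem the hypothesis passes from c to every f' in (c, h). Leading exponents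
then satisfy e + n • m = n • l + r for all n, so m - l ≥ -e/n on σ, whence l ≤ m. Division by h
concludes. -/
theorem PSeries.isCompletelyNormal : IsCompletelyNormal (PSeries K σ) := by
  intro c h d hh hd hdiv
  refine dvd_of_isLead_le (fun f' hf' m l hm hl => ?_) hh
  have hdiv' : ∀ n : ℕ, h ^ n ∣ d * f' ^ n := by
    intro n
    obtain ⟨x, y, rfl⟩ := Ideal.mem_span_pair.mp hf'
    rw [add_pow, Finset.mul_sum]
    refine Finset.dvd_sum fun k hk => ?_
    have hkn : k ≤ n := Nat.lt_succ_iff.mp (Finset.mem_range.mp hk)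
    obtain ⟨q, hq⟩ := hdiv k
    refine ⟨q * x ^ k * y ^ (n - k) * (n.choose k : PSeries K σ), ?_⟩
    calc d * ((x * c) ^ k * (y * h) ^ (n - k) * (n.choose k : PSeries K σ))
        = (d * c ^ k) * h ^ (n - k) * (x ^ k * y ^ (n - k) * (n.choose k : PSeries K σ)) := by ring
      _ = (h ^ k * h ^ (n - k)) * (q * x ^ k * y ^ (n - k) * (n.choose k : PSeries K σ)) := by
          rw [hq]; ring
      _ = h ^ n * (q * x ^ k * y ^ (n - k) * (n.choose k : PSeries K σ)) := by
          rw [← pow_add, Nat.add_sub_cancel' hkn]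
  obtain ⟨e, he⟩ := exists_isLead hd
  intro w hw
  have key : ∀ n : ℕ, 0 ≤ e.1 w + n * (m.1 w - l.1 w) := by
    intro n
    obtain ⟨q, hq⟩ := hdiv' n
    have hL : IsLead (d * f' ^ n) (e + n • m) := he.mul (hm.pow n)
    have hq0 : q ≠ 0 := by
      rintro rfl
      exact hL.ne_zero (by rw [hq, mul_zero])
    obtain ⟨r, hr⟩ := exists_isLead hq0
    have hR : IsLead (d * f' ^ n) (n • l + r) := by rw [hq]; exact (hl.pow n).mul hr
    have h1 := congrArg (fun m : Exps σ => m.1 w) (hL.unique hR)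
    simp only [AddSubmonoid.coe_add, AddSubmonoidClass.coe_nsmul, LinearMap.add_apply,
      LinearMap.smul_apply, nsmul_eq_mul] at h1
    have h2 := r.2.2 w hw
    rw [mul_sub]
    linarith
  by_contra! hlt
  obtain ⟨n, hn⟩ := exists_nat_gt (e.1 w / (l.1 w - m.1 w))
  rw [div_lt_iff₀ (sub_pos.mpr hlt)] at hn
  have := key n
  linarith

/-- The ideal of the series with exponents in an ideal of the monoid of exponents. -/
def supportIdeal (K : Type*) [Field K] (A : Set (Exps σ)) (hA : ∀ a ∈ A, ∀ b, a + b ∈ A) :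
    Ideal (PSeries K σ) where
  carrier := {f | f.support ⊆ A}
  zero_mem' := by simp
  add_mem' {f g} hf hg m hm := by
    by_cases h : f.coeff m = 0
    · refine hg fun h' => hm ?_
      rw [HahnSeries.coeff_add, h, h', add_zero]
    · exact hf h
  smul_mem' c f hf m hm := by
    rw [smul_eq_mul, mul_comm] at hm
    obtain ⟨x, hx, y, hy, rfl⟩ := Set.mem_add.mp (HahnSeries.support_mul_subset hm)
    exact hA x (hf hx) y

theorem mem_supportIdeal {A : Set (Exps σ)} {hA : ∀ a ∈ A, ∀ b, a + b ∈ A} {f : PSeries K σ} :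
    f ∈ supportIdeal K A hA ↔ ∀ m ∈ f.support, m ∈ A := Iff.rfl

theorem chi_mem_supportIdeal {A : Set (Exps σ)} {hA : ∀ a ∈ A, ∀ b, a + b ∈ A} {a : Exps σ} :
    chi K a ∈ supportIdeal K A hA ↔ a ∈ A := by
  rw [mem_supportIdeal]
  refine ⟨fun h => h a (by simp [chi]), fun h m hm => ?_⟩
  rw [HahnSeries.eq_of_mem_support_single hm]
  exact h

/-- The prime ideal of the orbit closure attached to the face of `σ` containing `u` in its relative
interior. -/
def faceIdeal (K : Type*) [Field K] {u : V} (hu : u ∈ σ.cone) : Ideal (PSeries K σ) :=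
  supportIdeal K {m | 0 < m.1 u} fun _ ha b => add_pos_of_pos_of_nonneg ha (b.2.2 u hu)

theorem mem_faceIdeal {u : V} {hu : u ∈ σ.cone} {f : PSeries K σ} :
    f ∈ faceIdeal K hu ↔ ∀ m ∈ f.support, 0 < m.1 u := Iff.rfl

theorem chi_mem_faceIdeal {u : V} {hu : u ∈ σ.cone} {a : Exps σ} :
    chi K a ∈ faceIdeal K hu ↔ 0 < a.1 u := chi_mem_supportIdeal

/-- The lexicographically smallest exponents of f and g among those vanishing at u give a term of f
* g that cannot cancel. -/
theorem isPrime_faceIdeal {u : V} (hu : u ∈ σ.cone) : (faceIdeal K hu).IsPrime := by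
  refine ⟨fun h => ?_, fun {f g} hfg => ?_⟩
  · have h1 : chi K (0 : Exps σ) ∈ faceIdeal K hu := by rw [h]; trivial
    rw [chi_mem_faceIdeal] at h1
    exact lt_irrefl _ h1
  · by_contra! hcon
    have hmin : ∀ f : PSeries K σ, f ∉ faceIdeal K hu → ∃ a ∈ f.support, a.1 u = 0 ∧
        ∀ m ∈ f.support, m.1 u = 0 → lexKey a ≤ lexKey m := by
      intro f hf
      rw [mem_faceIdeal] at hf
      push Not at hf
      obtain ⟨m, hm, hmu⟩ := hf
      obtain ⟨a, ha, hmin⟩ := wellFounded_lexKey.has_min {m : Exps σ | m ∈ f.support ∧ m.1 u = 0}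
        ⟨m, hm, le_antisymm hmu (m.2.2 u hu)⟩
      exact ⟨a, ha.1, ha.2, fun m' h1 h2 => not_lt.mp (hmin m' ⟨h1, h2⟩)⟩
    obtain ⟨a, ha, hau, hamin⟩ := hmin f hcon.1
    obtain ⟨b, hb, hbu, hbmin⟩ := hmin g hcon.2
    have h1 : a + b ∈ (f * g).support := by
      rw [HahnSeries.mem_support, coeff_mul_add_of_min hu hau hbu hamin hbmin]
      exact mul_ne_zero ha hb
    have h2 : 0 < a.1 u + b.1 u := mem_faceIdeal.mp hfg _ h1
    rw [hau, hbu, add_zero] at h2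
    exact lt_irrefl _ h2

/-- The constant coefficient. -/
def constCoeff (K : Type*) [Field K] (σ : WeightCone N) : PSeries K σ →+* K where
  toFun f := f.coeff 0
  map_one' := by simp
  map_zero' := rfl
  map_add' _ _ := rfl
  map_mul' f g := by
    have := coeff_mul_add_of_min (f := f) (g := g) σ.cone.zero_mem (map_zero (0 : Exps σ).1)
      (map_zero (0 : Exps σ).1) (fun m _ _ => lexKey_zero_le m) fun m _ _ => lexKey_zero_le m
    rwa [add_zero] at this

theorem constCoeff_apply (f : PSeries K σ) : constCoeff K σ f = f.coeff 0 := rfl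

/-- The derivation which multiplies the coefficient of `χ^m` by `θ m`. -/
def toricDerivation (θ : Exps σ →+ K) : Derivation K (PSeries K σ) (PSeries K σ) :=
  Derivation.mk'
    { toFun := fun f => PSeries.ofCoeff fun m => θ m * f.coeff m
      map_add' := fun f g => by
        ext m
        simp [mul_add]
      map_smul' := fun c f => by
        ext m
        simp [mul_left_comm] }
    fun f g => by
      ext m
      rw [smul_eq_mul, smul_eq_mul, mul_comm g]
      simp only [LinearMap.coe_mk, AddHom.coe_mk, PSeries.coeff_ofCoeff,
        HahnSeries.coeff_add, PSeries.coeff_mul_antidiag]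
      rw [Finset.mul_sum, ← Finset.sum_add_distrib]
      refine Finset.sum_congr rfl fun p hp => ?_
      rw [← Exps.mem_antidiag.mp hp, map_add]
      ring

theorem toricDerivation_coeff (θ : Exps σ →+ K) (f : PSeries K σ) (m : Exps σ) :
    (toricDerivation θ f).coeff m = θ m * f.coeff m := rfl

/-- A series is a finite combination of monomials from its support. -/
theorem PSeries.exists_sum_chi_mul (f : PSeries K σ) : ∃ T : Finset (Exps σ),
    (∀ t ∈ T, t ∈ f.support) ∧ ∃ h : Exps σ → PSeries K σ, f = ∑ t ∈ T, chi K t * h t := by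
  classical
  obtain ⟨T, hT, hle⟩ := Exps.exists_finset_le f.support
  choose! sel hselT hsel using hle
  refine ⟨T, fun t ht => hT ht, fun t => PSeries.ofCoeff fun x =>
    if t + x ∈ f.support ∧ sel (t + x) = t then f.coeff (t + x) else 0, ?_⟩
  ext m
  rw [HahnSeries.coeff_sum]
  by_cases hm : m ∈ f.support
  · rw [Finset.sum_eq_single (sel m)]
    · obtain ⟨c, hc⟩ := Exps.le_iff_exists_add.mp (hsel m hm)
      conv_rhs => rw [hc]
      rw [← hc, show (chi K (sel m) * _).coeff m = (chi K (sel m) * _).coeff (sel m + c) by rw [← hc],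
        coeff_chi_mul_add, PSeries.coeff_ofCoeff, ← hc, if_pos ⟨hm, rfl⟩]
    · intro t _ hne
      by_cases hle : t ≤ m
      · obtain ⟨c, rfl⟩ := Exps.le_iff_exists_add.mp hle
        rw [coeff_chi_mul_add, PSeries.coeff_ofCoeff, if_neg fun h => hne h.2.symm]
      · exact coeff_chi_mul_of_not_le hle _
    · exact fun h => absurd (hselT m hm) h
  · have h0 : f.coeff m = 0 := not_not.mp hm
    rw [h0, Finset.sum_eq_zero]
    intro t _
    by_cases hle : t ≤ m
    · obtain ⟨c, rfl⟩ := Exps.le_iff_exists_add.mp hle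
      rw [coeff_chi_mul_add, PSeries.coeff_ofCoeff, if_neg fun h => hm h.1]
    · exact coeff_chi_mul_of_not_le hle _

end SeriesRing

/-! ### Real semivaluations on Noetherian rings. -/

section RealValuation

universe u

/-- Values are inverted, so that v ≤ 1 becomes non-negativity; `hb` says that the multiples of the
value of h are cofinal. -/
theorem Valuation.exists_real_log {F Γ₀ : Type*} [Field F] [LinearOrderedCommGroupWithZero Γ₀]
    (v : Valuation F Γ₀) (hv : Function.Surjective v) {h : F} (h0 : h ≠ 0) (h1 : v h < 1)
    (hb : ∀ z : F, z ≠ 0 → ∃ n : ℕ, v z * v h ^ n ≤ 1) :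
    ∃ L : F → ℝ, (∀ x y, x ≠ 0 → y ≠ 0 → L (x * y) = L x + L y) ∧
      (∀ x, x ≠ 0 → v x ≤ 1 → 0 ≤ L x) ∧ L h = 1 := by
  classical
  let U : (x : F) → x ≠ 0 → Additive Γ₀ˣ := fun x hx =>
    Additive.ofMul (Units.mk0 (v x) ((Valuation.ne_zero_iff v).mpr hx))⁻¹
  have hU : ∀ x (hx : x ≠ 0), v x ≤ 1 → 0 ≤ U x hx := by
    intro x hx hle
    change (1 : Γ₀ˣ) ≤ (Units.mk0 (v x) _)⁻¹
    rw [one_le_inv', ← Units.val_le_val]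
    exact hle
  have hUmul : ∀ x y (hx : x ≠ 0) (hy : y ≠ 0), U (x * y) (mul_ne_zero hx hy) = U x hx + U y hy := by
    intro x y hx hy
    change (Units.mk0 (v (x * y)) _)⁻¹ = (Units.mk0 (v x) _)⁻¹ * (Units.mk0 (v y) _)⁻¹
    rw [← mul_inv]
    congr 1
    ext
    simp
  have hγ : 0 < U h h0 := by
    change (1 : Γ₀ˣ) < (Units.mk0 (v h) _)⁻¹
    rw [one_lt_inv', ← Units.val_lt_val]
    exact h1
  obtain ⟨L, hadd, hpos, hone⟩ := exists_monotone_real_hom hγ (fun g => by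
    obtain ⟨z, hz⟩ := hv (Units.val (Additive.toMul g))
    have hz0 : z ≠ 0 := by
      rintro rfl
      rw [map_zero] at hz
      exact (Units.ne_zero _) hz.symm
    obtain ⟨n, hn⟩ := hb z hz0
    refine ⟨n, ?_⟩
    change Additive.toMul g ≤ ((Units.mk0 (v h) _)⁻¹) ^ n
    rw [inv_pow, le_inv_iff_mul_le_one_right, ← Units.val_le_val]
    simpa [← hz] using hn)
  refine ⟨fun x => if hx : x ≠ 0 then L (U x hx) else 0, fun x y hx hy => ?_, fun x hx hle => ?_, ?_⟩
  · simp only [dif_pos hx, dif_pos hy, dif_pos (mul_ne_zero hx hy)]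
    rw [hUmul x y hx hy, hadd]
  · simp only [dif_pos hx]
    exact hpos _ (hU x hx hle)
  · simp only [dif_pos h0]
    exact hone

/-- A one-dimensional local Noetherian domain `A` carries a real valuation which is positive on the
maximal ideal. The last property is the ultrametric inequality for finite sums. -/
theorem exists_real_valuation (A F : Type*) [CommRing A] [IsDomain A] [IsLocalRing A]
    [IsNoetherianRing A] [Field F] [Algebra A F] [IsFractionRing A F] {h : A} (h0 : h ≠ 0)
    (hm : h ∈ IsLocalRing.maximalIdeal A)
    (hprime : ∀ Q : Ideal A, Q.IsPrime → Q ≠ ⊥ → h ∈ Q) :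
    ∃ L : A → ℝ, (∀ x y, x ≠ 0 → y ≠ 0 → L (x * y) = L x + L y) ∧ (∀ x, x ≠ 0 → 0 ≤ L x) ∧
      (∀ x ∈ IsLocalRing.maximalIdeal A, x ≠ 0 → 0 < L x) ∧
      ∀ (ι : Type u) (T : Finset ι) (a : A) (x : ι → A), a ≠ 0 → a + ∑ t ∈ T, x t = 0 →
        ∃ t ∈ T, x t ≠ 0 ∧ L (x t) ≤ L a := by
  -- A valuation ring dominating A may have higher rank, and passing to real values only preserves
  -- weak inequalities. Strict positivity on the maximal ideal is recovered from L h = 1, since h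
  -- divides a power of each of its elements.
  obtain ⟨O, hO, hOloc⟩ := IsLocalRing.exists_factor_valuationRing (algebraMap A F)
  have hAinj : Function.Injective (algebraMap A F) := IsFractionRing.injective A F
  have hA0 : ∀ {x : A}, x ≠ 0 → algebraMap A F x ≠ 0 := fun hx h =>
    hx (hAinj (by rw [h, map_zero]))
  have hle1 : ∀ x : A, O.valuation (algebraMap A F x) ≤ 1 := fun x =>
    (O.valuation_le_one_iff _).mpr (hO x)
  have hlt1 : ∀ x ∈ IsLocalRing.maximalIdeal A, O.valuation (algebraMap A F x) < 1 := by
    intro x hx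
    refine (O.valuation_lt_one_or_eq_one ⟨algebraMap A F x, hO x⟩).resolve_right fun h1 => hx ?_
    exact hOloc.map_nonunit x ((O.valuation_eq_one_iff ⟨algebraMap A F x, hO x⟩).mpr h1)
  obtain ⟨L, hLmul, hLpos, hLh⟩ := Valuation.exists_real_log O.valuation O.valuation_surjective
    (hA0 h0) (hlt1 _ hm) (by
      intro z hz
      obtain ⟨a, b, hb, rfl⟩ := IsFractionRing.div_surjective (A := A) z
      have hb0 : b ≠ 0 := nonZeroDivisors.ne_zero hb
      obtain ⟨k, c, hc⟩ := exists_pow_dvd_of_ne_zero hprime hb0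
      refine ⟨k, ?_⟩
      have h2 : algebraMap A F a / algebraMap A F b * algebraMap A F h ^ k
          = algebraMap A F (a * c) := by
        rw [← map_pow, hc, map_mul, map_mul, div_mul_eq_mul_div, div_eq_iff (hA0 hb0)]
        ring
      rw [← map_pow, ← map_mul, h2]
      exact hle1 _)
  have hLmono : ∀ x y, x ≠ 0 → y ≠ 0 → O.valuation x ≤ O.valuation y → L y ≤ L x := by
    intro x y hx hy hxy
    have h1 : L (y * (x / y)) = L y + L (x / y) := hLmul _ _ hy (div_ne_zero hx hy)
    rw [mul_div_cancel₀ _ hy] at h1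
    have h2 := hLpos (x / y) (div_ne_zero hx hy) (by
      rw [map_div₀]
      exact div_le_one_of_le₀ hxy zero_le)
    linarith
  refine ⟨fun x => L (algebraMap A F x), ?_, ?_, ?_, ?_⟩
  · intro x y hx hy
    simp only [map_mul]
    exact hLmul _ _ (hA0 hx) (hA0 hy)
  · intro x hx
    exact hLpos _ (hA0 hx) (hle1 _)
  · intro x hxn hx
    have hx0 := hA0 hx
    obtain ⟨k, c, hc⟩ := exists_pow_dvd_of_mem_maximalIdeal h0 hm hprime hxn
    have h1 : algebraMap A F x ^ k = algebraMap A F h * algebraMap A F c := by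
      rw [← map_pow, ← map_mul, hc]
    have hc0 : algebraMap A F c ≠ 0 := fun h => pow_ne_zero k hx0 (by rw [h1, h, mul_zero])
    have hpow : ∀ k : ℕ, L (algebraMap A F x ^ k) = k * L (algebraMap A F x) := by
      intro k
      induction k with
      | zero =>
        have := hLmul 1 1 one_ne_zero one_ne_zero
        rw [one_mul] at this
        simp only [pow_zero, Nat.cast_zero, zero_mul]
        linarith
      | succ k ih =>
        rw [pow_succ, hLmul _ _ (pow_ne_zero k hx0) hx0, ih]
        push_cast
        ring
    have h2 := hpow k
    rw [h1, hLmul _ _ (hA0 h0) hc0, hLh] at h2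
    have h3 := hLpos _ hc0 (hle1 c)
    by_contra! hle
    have h4 : (k : ℝ) * L (algebraMap A F x) ≤ 0 :=
      mul_nonpos_of_nonneg_of_nonpos (by positivity) hle
    linarith
  · intro ι T a x ha hsum
    have h1 : algebraMap A F a = -∑ t ∈ T, algebraMap A F (x t) := by
      rw [eq_neg_of_add_eq_zero_left hsum, map_neg, map_sum]
    by_contra! hcon
    have h2 : O.valuation (∑ t ∈ T, algebraMap A F (x t)) < O.valuation (algebraMap A F a) := by
      refine Valuation.map_sum_lt _ ((Valuation.ne_zero_iff _).mpr (hA0 ha)) fun t ht => ?_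
      by_cases hx : x t = 0
      · rw [hx, map_zero, map_zero]
        exact zero_lt_iff.mpr ((Valuation.ne_zero_iff _).mpr (hA0 ha))
      · by_contra! hle
        exact absurd (hLmono _ _ (hA0 ha) (hA0 hx) hle) (not_le.mpr (hcon t ht hx))
    rw [h1, Valuation.map_neg] at h2
    exact lt_irrefl _ h2

/-- A Noetherian ring in which no multiple of a power of `h` by an element outside of the prime
ideal `𝔫` belongs to `J` admits a real semivaluation centred in `𝔫`, infinite on `J` and finite at
`h`. -/
theorem exists_real_semivaluation {B : Type*} [CommRing B] [IsNoetherianRing B] (𝔫 J : Ideal B)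
    [𝔫.IsPrime] {h : B} (hn : h ∈ 𝔫) (hJ : ∀ s ∉ 𝔫, ∀ n : ℕ, s * h ^ n ∉ J) :
    ∃ (P : Ideal B) (L : B → ℝ), P.IsPrime ∧ J ≤ P ∧ h ∉ P ∧
      (∀ x y, x ∉ P → y ∉ P → L (x * y) = L x + L y) ∧ (∀ x, x ∉ P → 0 ≤ L x) ∧
      (∀ x ∈ 𝔫, x ∉ P → 0 < L x) ∧
      ∀ (ι : Type u) (T : Finset ι) (a : B) (x : ι → B), a ∉ P → a + ∑ t ∈ T, x t ∈ P →
        ∃ t ∈ T, x t ∉ P ∧ L (x t) ≤ L a := by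
  let A₀ := Localization.AtPrime 𝔫
  let φ : B →+* A₀ := algebraMap B A₀
  have hJ₀ : ∀ n : ℕ, φ h ^ n ∉ J.map φ := by
    intro n hmem
    rw [← map_pow, IsLocalization.algebraMap_mem_map_algebraMap_iff 𝔫.primeCompl] at hmem
    obtain ⟨s, hs, hsJ⟩ := hmem
    exact hJ s hs n hsJ
  have hnoeth : IsNoetherianRing A₀ := IsLocalization.isNoetherianRing 𝔫.primeCompl A₀ inferInstance
  -- Maximality among the primes avoiding h makes h lie in every non-zero prime of the quotient, as
  -- `exists_real_valuation` requires.
  obtain ⟨P, ⟨hP, hJP, hhP⟩, hmax⟩ : ∃ P ∈ {P : Ideal A₀ | P.IsPrime ∧ J.map φ ≤ P ∧ φ h ∉ P},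
      ∀ Q ∈ {P : Ideal A₀ | P.IsPrime ∧ J.map φ ≤ P ∧ φ h ∉ P}, ¬ P < Q :=
    set_has_maximal_iff_noetherian.mpr hnoeth _ (by
      obtain ⟨P, hP, hle, hdisj⟩ := Ideal.exists_le_prime_disjoint (J.map φ)
        (Submonoid.powers (φ h)) (Set.disjoint_left.mpr (by
          rintro _ hx ⟨n, rfl⟩
          exact hJ₀ n hx))
      exact ⟨P, hP, hle, fun hmem => Set.disjoint_left.mp hdisj hmem (Submonoid.mem_powers _)⟩)
  let A := A₀ ⧸ P
  let π : A₀ →+* A := Ideal.Quotient.mk P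
  have hlocal : IsLocalRing A := IsLocalRing.of_surjective' π Ideal.Quotient.mk_surjective
  have hnu : ∀ x ∈ 𝔫, π (φ x) ∈ IsLocalRing.maximalIdeal A := by
    intro x hx
    rw [IsLocalRing.mem_maximalIdeal, mem_nonunits_iff]
    intro hu
    obtain ⟨y, hy⟩ := hu.exists_right_inv
    obtain ⟨y, rfl⟩ := Ideal.Quotient.mk_surjective y
    have h1 : φ x * y - 1 ∈ P := by
      rw [← Ideal.Quotient.eq_zero_iff_mem, map_sub, map_mul, map_one, sub_eq_zero]
      exact hy
    have h2 : φ x * y ∈ IsLocalRing.maximalIdeal A₀ :=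
      Ideal.mul_mem_right _ _ ((IsLocalization.AtPrime.to_map_mem_maximal_iff A₀ 𝔫 x).mpr hx)
    have h3 := Ideal.sub_mem _ h2 (IsLocalRing.le_maximalIdeal hP.ne_top h1)
    rw [sub_sub_cancel] at h3
    exact (Ideal.ne_top_iff_one _).mp (IsLocalRing.maximalIdeal.isMaximal A₀).ne_top h3
  have hne : ∀ x, π x = 0 ↔ x ∈ P := fun x => Ideal.Quotient.eq_zero_iff_mem
  have hprime : ∀ Q : Ideal A, Q.IsPrime → Q ≠ ⊥ → π (φ h) ∈ Q := by
    intro Q hQ hQ0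
    by_contra hcon
    have hlt : P < Q.comap π := by
      refine lt_of_le_of_ne (fun x hx => ?_) fun heq => hQ0 ?_
      · rw [Ideal.mem_comap, (hne x).mpr hx]; exact Q.zero_mem
      · refine le_bot_iff.mp fun y hy => ?_
        obtain ⟨x, rfl⟩ := Ideal.Quotient.mk_surjective y
        have : x ∈ Q.comap π := hy
        rw [← heq] at this
        exact (hne x).mpr this
    exact hmax (Q.comap π) ⟨hQ.comap π, hJP.trans hlt.le, hcon⟩ hlt
  have hdom : IsDomain A := (Ideal.Quotient.isDomain_iff_prime P).mpr hP
  obtain ⟨L, hLmul, hLpos, hLmax, hLsum⟩ := exists_real_valuation A (FractionRing A)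
    (fun h0 => hhP ((hne _).mp h0)) (hnu h hn) hprime
  have hne' : ∀ x : B, x ∉ P.comap φ → π (φ x) ≠ 0 := fun x hx h => hx ((hne _).mp h)
  refine ⟨P.comap φ, fun x => L (π (φ x)), hP.comap φ, Ideal.map_le_iff_le_comap.mp hJP, hhP,
    ?_, ?_, ?_, ?_⟩
  · intro x y hx hy
    simp only [map_mul]
    exact hLmul _ _ (hne' x hx) (hne' y hy)
  · exact fun x hx => hLpos _ (hne' x hx)
  · exact fun x hxn hx => hLmax _ (hnu x hxn) (hne' x hx)
  · intro ι T a x ha hmem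
    obtain ⟨t, ht, ht0, htL⟩ := hLsum ι T (π (φ a)) (fun t => π (φ (x t))) (hne' a ha) (by
      rw [← map_sum, ← map_sum, ← map_add, ← map_add]
      exact (hne _).mpr hmem)
    exact ⟨t, ht, fun hmem => ht0 ((hne _).mpr hmem), htL⟩

end RealValuation

/-! ### Monomials in initial ideals. -/

section InitialForms

variable {V : Type*} [NormedAddCommGroup V] [NormedSpace ℝ V] {N : Submodule ℤ V}

variable {σ : WeightCone N} {K : Type*} [Field K]

theorem coeff_C_mul (κ : K) (f : PSeries K σ) (m : Exps σ) :
    (HahnSeries.C κ * f).coeff m = κ * f.coeff m := by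
  rw [HahnSeries.C_apply, HahnSeries.coeff_single_zero_mul]

theorem coeff_chi_self (m : Exps σ) : (chi K m).coeff m = 1 := HahnSeries.coeff_single_same _ _

theorem coeff_chi_of_ne {m m' : Exps σ} (h : m' ≠ m) : (chi K m).coeff m' = 0 :=
  HahnSeries.coeff_single_of_ne h

theorem chi_mem_initialIdeal {w : V} {I : Ideal (PSeries K σ)} {f : PSeries K σ} (hf : f ∈ I)
    {m : Exps σ} (hm : m ∈ f.support) (hmin : ∀ m' ∈ f.support, m' ≠ m → m.1 w < m'.1 w) :
    chi K m ∈ initialIdeal w I := by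
  have h1 : chi K m = HahnSeries.C (f.coeff m)⁻¹ * initialForm w f := by
    ext x
    rw [coeff_C_mul, initialForm, PSeries.coeff_ofCoeff]
    by_cases hx : x = m
    · subst hx
      rw [if_pos, coeff_chi_self, inv_mul_cancel₀ hm]
      refine ⟨hm, fun m' hm' => ?_⟩
      by_cases h : m' = x
      · rw [h]
      · exact (hmin m' hm' h).le
    · rw [if_neg, mul_zero, coeff_chi_of_ne hx]
      rintro ⟨h1, h2⟩
      exact absurd (h2 m hm) (not_le.mpr (hmin x h1 hx))
  rw [h1]
  exact Ideal.mul_mem_left _ _ (Ideal.subset_span ⟨f, hf, rfl⟩)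

/-- Only the part of r of weight d minus the order of g contributes in weight d; g times that part
is the wanted element. -/
theorem exists_mem_of_mul_initialForm (w : V) {I : Ideal (PSeries K σ)} {g : PSeries K σ}
    (hg : g ∈ I) (r : PSeries K σ) (d : ℝ) : ∃ f ∈ I, ∀ m : Exps σ,
      (m.1 w < d → f.coeff m = 0) ∧ (m.1 w = d → f.coeff m = (r * initialForm w g).coeff m) := by
  classical
  by_cases h0 : (basisRel w g).Nonempty
  · obtain ⟨m₀, hm₀, hmin⟩ := h0
    have hin : ∀ m, (initialForm w g).coeff m = if m.1 w = m₀.1 w then g.coeff m else 0 := by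
      intro m
      rw [initialForm, PSeries.coeff_ofCoeff]
      by_cases hm : m ∈ g.support
      · refine if_congr ⟨fun h => le_antisymm (h.2 m₀ hm₀) (hmin m hm), fun h => ⟨hm, ?_⟩⟩ rfl rfl
        rw [h]
        exact hmin
      · rw [if_neg fun h => hm h.1, not_not.mp hm, ite_self]
    refine ⟨PSeries.ofCoeff (fun a => if a.1 w = d - m₀.1 w then r.coeff a else 0) * g,
      I.mul_mem_left _ hg, fun m => ⟨fun hm => ?_, fun hm => ?_⟩⟩
    · rw [PSeries.coeff_mul_antidiag]
      refine Finset.sum_eq_zero fun p hp => ?_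
      have hp' : p.1.1 w + p.2.1 w = m.1 w := by rw [← Exps.mem_antidiag.mp hp]; rfl
      rw [PSeries.coeff_ofCoeff]
      by_cases h1 : p.1.1 w = d - m₀.1 w
      · have h2 : p.2 ∉ g.support := fun h => by
          have := hmin _ h
          linarith
        rw [not_not.mp h2, mul_zero]
      · rw [if_neg h1, zero_mul]
    · rw [PSeries.coeff_mul_antidiag, PSeries.coeff_mul_antidiag]
      refine Finset.sum_congr rfl fun p hp => ?_
      have hp' : p.1.1 w + p.2.1 w = m.1 w := by rw [← Exps.mem_antidiag.mp hp]; rfl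
      rw [PSeries.coeff_ofCoeff, hin]
      by_cases h1 : p.1.1 w = d - m₀.1 w
      · rw [if_pos h1, if_pos (by linarith)]
      · rw [if_neg h1, if_neg (fun h => h1 (by linarith)), zero_mul, mul_zero]
  · refine ⟨0, I.zero_mem, fun m => ⟨fun _ => rfl, fun _ => ?_⟩⟩
    have : initialForm w g = 0 := by
      ext m
      rw [initialForm, PSeries.coeff_ofCoeff, if_neg fun h => h0 ⟨m, h⟩, HahnSeries.coeff_zero]
    rw [this, mul_zero]

/-- If the initial ideal of `I` contains a monomial, this monomial is the initial form of an element
of `I`. -/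
theorem exists_of_chi_mem_initialIdeal {w : V} {I : Ideal (PSeries K σ)} {m : Exps σ}
    (h : chi K m ∈ initialIdeal w I) : ∃ f ∈ I, f.coeff m = 1 ∧
      ∀ m' ∈ f.support, m' ≠ m → m.1 w < m'.1 w := by
  obtain ⟨n, r, g, hsum⟩ := Submodule.mem_span_set'.mp h
  have hg : ∀ i, ∃ g' ∈ I, initialForm w g' = g i := fun i => (g i).2
  choose g' hg' hgg' using hg
  choose F hF hFm using fun i => exists_mem_of_mul_initialForm w (hg' i) (r i) (m.1 w)
  have key : ∀ m' : Exps σ, (m'.1 w < m.1 w → (∑ i, F i).coeff m' = 0) ∧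
      (m'.1 w = m.1 w → (∑ i, F i).coeff m' = (chi K m).coeff m') := by
    intro m'
    refine ⟨fun h => ?_, fun h => ?_⟩
    · rw [HahnSeries.coeff_sum]
      exact Finset.sum_eq_zero fun i _ => (hFm i m').1 h
    · rw [← hsum, HahnSeries.coeff_sum, HahnSeries.coeff_sum]
      refine Finset.sum_congr rfl fun i _ => ?_
      rw [(hFm i m').2 h, hgg' i, smul_eq_mul]
  refine ⟨∑ i, F i, I.sum_mem fun i _ => hF i, ?_, fun m' hm' hne => ?_⟩
  · rw [(key m).2 rfl, coeff_chi_self]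
  · by_contra! hle
    refine hm' ?_
    rcases hle.lt_or_eq with h | h
    · exact (key m').1 h
    · rw [(key m').2 h, coeff_chi_of_ne hne]

end InitialForms

/-! ### Fractions of positive order on a set of weights. -/

section PositiveFractions

variable {V : Type*} [NormedAddCommGroup V] [NormedSpace ℝ V] {N : Submodule ℤ V}

variable {σ : WeightCone N} {K : Type*} [Field K]

/-- The fractions `x` of series by monomials which have positive order along all the weights in `W`. -/
def IsPositive {A : Type*} [CommRing A] [Algebra (PSeries K σ) A] (W : Set V) (x : A) : Prop :=
  ∃ (c : Exps σ) (f : PSeries K σ),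
    algebraMap (PSeries K σ) A f = algebraMap (PSeries K σ) A (chi K c) * x ∧
    ∀ w ∈ W, ∀ m ∈ f.support, c.1 w < m.1 w

variable {A : Type*} [CommRing A] [Algebra (PSeries K σ) A] {W : Set V}

theorem IsPositive.add {x y : A} (hx : IsPositive (K := K) (σ := σ) W x)
    (hy : IsPositive (K := K) (σ := σ) W y) : IsPositive (K := K) (σ := σ) W (x + y) := by
  obtain ⟨c, f, hf, hfW⟩ := hx
  obtain ⟨d, g, hg, hgW⟩ := hy
  refine ⟨c + d, chi K d * f + chi K c * g, ?_, fun w hw m hm => ?_⟩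
  · rw [map_add, map_mul, map_mul, hf, hg, chi_add, map_mul]
    ring
  · by_cases h : m ∈ (chi K d * f).support
    · obtain ⟨b, hb, rfl⟩ := mem_support_chi_mul h
      have := hfW w hw b hb
      change c.1 w + d.1 w < d.1 w + b.1 w
      linarith
    · have h' : m ∈ (chi K c * g).support := fun h' => hm (by
        rw [HahnSeries.coeff_add, not_not.mp h, h', add_zero])
      obtain ⟨b, hb, rfl⟩ := mem_support_chi_mul h'
      have := hgW w hw b hb
      change c.1 w + d.1 w < c.1 w + b.1 w
      linarith

theorem IsPositive.mul {x y : A} (hx : IsPositive (K := K) (σ := σ) W x)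
    (hy : IsPositive (K := K) (σ := σ) W y) : IsPositive (K := K) (σ := σ) W (x * y) := by
  obtain ⟨c, f, hf, hfW⟩ := hx
  obtain ⟨d, g, hg, hgW⟩ := hy
  refine ⟨c + d, f * g, ?_, fun w hw m hm => ?_⟩
  · rw [map_mul, hf, hg, chi_add, map_mul]
    ring
  · obtain ⟨a, ha, b, hb, rfl⟩ := Set.mem_add.mp (HahnSeries.support_mul_subset hm)
    exact add_lt_add (hfW w hw a ha) (hgW w hw b hb)

theorem IsPositive.algebraMap_mul {x : A} (hW : W ⊆ σ.cone)
    (hx : IsPositive (K := K) (σ := σ) W x) (r : PSeries K σ) :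
    IsPositive (K := K) (σ := σ) W (algebraMap (PSeries K σ) A r * x) := by
  obtain ⟨c, f, hf, hfW⟩ := hx
  refine ⟨c, r * f, ?_, fun w hw m hm => ?_⟩
  · rw [map_mul, hf]
    ring
  · obtain ⟨a, ha, b, hb, rfl⟩ := Set.mem_add.mp (HahnSeries.support_mul_subset hm)
    have h1 := hfW w hw b hb
    have h2 := a.2.2 w (hW hw)
    change c.1 w < a.1 w + b.1 w
    linarith

theorem IsPositive.of_coeff_zero [FiniteDimensional ℝ V] [DiscreteTopology N] [IsZLattice ℝ N]
    (hW : W ⊆ interior (σ.cone : Set V)) {r : PSeries K σ} (hr : r.coeff 0 = 0) :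
    IsPositive (K := K) (σ := σ) W (algebraMap (PSeries K σ) A r) := by
  refine ⟨0, r, ?_, fun w hw m hm => ?_⟩
  · rw [chi_zero, map_one, one_mul]
  · have hm0 : m ≠ 0 := by
      rintro rfl
      exact hm hr
    exact σ.exps_pos_of_mem_interior (hW hw) hm0

end PositiveFractions

/-! ### One dominant term for an open cone of weights. -/

section DominantTerm

variable {V : Type*} [NormedAddCommGroup V] [NormedSpace ℝ V] {N : Submodule ℤ V}

variable {σ : WeightCone N} {K : Type*} [Field K]

variable (K σ) in
/-- The submonoid of monomials. -/
def monomialSubmonoid : Submonoid (PSeries K σ) where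
  carrier := Set.range (chi K)
  one_mem' := ⟨0, chi_zero⟩
  mul_mem' := by
    rintro _ _ ⟨a, rfl⟩ ⟨b, rfl⟩
    exact ⟨a + b, chi_add a b⟩

theorem chi_mem_monomialSubmonoid (a : Exps σ) : chi K a ∈ monomialSubmonoid σ K := ⟨a, rfl⟩

theorem monomialSubmonoid_le : monomialSubmonoid σ K ≤ nonZeroDivisors (PSeries K σ) := by
  rintro _ ⟨a, rfl⟩
  exact mem_nonZeroDivisors_of_ne_zero (chi_ne_zero a)

/-- An element of the localization at the monomials which has a dominant constant term and belongs,
up to a monomial, to the extension of `I`, yields an element of `I` with a dominant term. -/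
theorem exists_dominant_of_isPositive {I : Ideal (PSeries K σ)} {W : Set V}
    (hW : W.Nonempty) {y : Localization (monomialSubmonoid σ K)}
    {κ : K} (hκ : κ ≠ 0) (hy : IsPositive (K := K) (σ := σ) W
      (y - algebraMap (PSeries K σ) _ (HahnSeries.C κ))) {a : Exps σ}
    (hyI : y * algebraMap (PSeries K σ) _ (chi K a) ∈
      I.map (algebraMap (PSeries K σ) (Localization (monomialSubmonoid σ K)))) :
    ∃ f ∈ I, ∃ c ∈ f.support, ∀ w ∈ W, ∀ m ∈ f.support, m ≠ c → c.1 w < m.1 w := by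
  obtain ⟨c, f, hf, hfW⟩ := hy
  obtain ⟨w₁, hw₁⟩ := hW
  let RL := Localization (monomialSubmonoid σ K)
  have hinj : Function.Injective (algebraMap (PSeries K σ) RL) :=
    IsLocalization.injective RL monomialSubmonoid_le
  have h1 : algebraMap (PSeries K σ) RL (chi K a * (chi K c * HahnSeries.C κ + f))
      = algebraMap (PSeries K σ) RL (chi K c) * (y * algebraMap (PSeries K σ) RL (chi K a)) := by
    rw [map_mul, map_add, map_mul, hf]
    ring
  have h2 := Ideal.mul_mem_left _ (algebraMap (PSeries K σ) RL (chi K c)) hyI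
  rw [← h1, IsLocalization.algebraMap_mem_map_algebraMap_iff (monomialSubmonoid σ K)] at h2
  obtain ⟨_, ⟨b, rfl⟩, hb⟩ := h2
  have h3 : chi K b * (chi K a * (chi K c * HahnSeries.C κ + f))
      = HahnSeries.C κ * chi K (b + a + c) + chi K (b + a) * f := by
    rw [chi_add, chi_add]
    ring
  rw [h3] at hb
  have hfc : f.coeff c = 0 := by
    by_contra h
    exact lt_irrefl _ (hfW w₁ hw₁ c h)
  refine ⟨_, hb, b + a + c, ?_, fun w hw m hm hne => ?_⟩
  · rw [HahnSeries.mem_support, HahnSeries.coeff_add, coeff_C_mul, coeff_chi_self,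
      coeff_chi_mul_add, hfc, mul_one, add_zero]
    exact hκ
  · have h4 : m ∈ (chi K (b + a) * f).support := by
      rw [HahnSeries.mem_support, HahnSeries.coeff_add, coeff_C_mul, coeff_chi_of_ne hne,
        mul_zero, zero_add] at hm
      exact hm
    obtain ⟨x, hx, rfl⟩ := mem_support_chi_mul h4
    have := hfW w hw x hx
    change (b + a).1 w + c.1 w < (b + a).1 w + x.1 w
    linarith

variable [FiniteDimensional ℝ V] [DiscreteTopology N] [IsZLattice ℝ N]

/-- Positive fractions absorb sums, products and series factors, so evaluating at them changes only
the constant term by something not positive: p(u) is its constant term plus a positive fraction. -/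
theorem isPositive_eval {ι : Type*} {W : Set V} (hW : W ⊆ interior (σ.cone : Set V))
    {A : Type*} [CommRing A] [Algebra (PSeries K σ) A] (u : ι → A)
    (hu : ∀ i, IsPositive (K := K) (σ := σ) W (u i)) (p : MvPolynomial ι (PSeries K σ)) :
    IsPositive (K := K) (σ := σ) W (MvPolynomial.eval₂Hom (algebraMap (PSeries K σ) A) u p -
      algebraMap (PSeries K σ) A
        (HahnSeries.C (MvPolynomial.eval₂Hom (constCoeff K σ) (fun _ => 0) p))) := by
  have hW' : W ⊆ σ.cone := hW.trans interior_subset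
  induction p using MvPolynomial.induction_on with
  | C r =>
    rw [MvPolynomial.eval₂Hom_C, MvPolynomial.eval₂Hom_C, ← map_sub]
    refine IsPositive.of_coeff_zero hW ?_
    rw [HahnSeries.coeff_sub, HahnSeries.C_apply, HahnSeries.coeff_single_same, constCoeff_apply,
      sub_self]
  | add p q hp hq =>
    rw [map_add, map_add, map_add, map_add, add_sub_add_comm]
    exact hp.add hq
  | mul_X p i hp =>
    rw [map_mul, map_mul, MvPolynomial.eval₂Hom_X', MvPolynomial.eval₂Hom_X', mul_zero, map_zero,
      map_zero, sub_zero]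
    have h1 := (hp.mul (hu i)).add ((hu i).algebraMap_mul hW'
      (HahnSeries.C (MvPolynomial.eval₂Hom (constCoeff K σ) (fun _ => 0) p)))
    rwa [← add_mul, sub_add_cancel] at h1

/-- If the initial ideals of `I` contain monomials for all the weights in a non-empty open subcone,
then some element of `I` has a term which dominates over this subcone. -/
theorem exists_dominant_term {I : Ideal (PSeries K σ)} (F : Finset (Module.Dual ℝ V))
    (hF : ∀ m ∈ F, m ∈ dualLattice N) {w₁ : V} (hw₁ : w₁ ∈ interior (σ.cone : Set V))
    (hFw₁ : ∀ m ∈ F, 0 < m w₁)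
    (hI : ∀ w ∈ interior (σ.cone : Set V), (∀ m ∈ F, 0 < m w) → ∃ m, chi K m ∈ initialIdeal w I) :
    ∃ f ∈ I, ∃ c ∈ f.support, ∀ w ∈ interior (σ.cone : Set V), (∀ m ∈ F, 0 < m w) →
      ∀ m ∈ f.support, m ≠ c → c.1 w < m.1 w := by
  classical
  -- Degenerate case: χ^height = 1 is a unit, but 0 is then the only interior weight and the weight
  -- w₁ alone suffices.
  by_cases hH : σ.height = 0
  · obtain ⟨m, hm⟩ := hI w₁ hw₁ hFw₁
    obtain ⟨f, hf, hfm, hmin⟩ := exists_of_chi_mem_initialIdeal hm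
    have hz : ∀ w ∈ interior (σ.cone : Set V), w = 0 := fun w hw => by
      by_contra h0
      have := σ.height_pos (interior_subset hw) h0
      rw [hH] at this
      exact lt_irrefl _ this
    refine ⟨f, hf, m, by rw [HahnSeries.mem_support, hfm]; exact one_ne_zero, fun w hw _ => ?_⟩
    rwa [hz w hw, ← hz w₁ hw₁]
  choose! k hk using fun (m : Module.Dual ℝ V) hm => σ.exists_add_height (m := m) hm
  let a : F → Exps σ := fun j => k j • σ.height
  let b : F → Exps σ := fun j => ⟨_, hk j (hF j j.2)⟩
  have hab : ∀ (j : F) (w : V), (b j).1 w = j.1 w + (a j).1 w := fun j w => rfl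
  let B := MvPolynomial F (PSeries K σ)
  -- J forces X_j to be χ^{b j}/χ^{a j}, the character j. A semivaluation centred in the kernel of ψ
  -- is positive on all χ^m with m ≠ 0 and on all X_j, so it gives an interior weight that is
  -- positive on F.
  let J : Ideal B := I.map MvPolynomial.C ⊔ Ideal.span (Set.range fun j : F =>
    MvPolynomial.C (chi K (a j)) * MvPolynomial.X j - MvPolynomial.C (chi K (b j)))
  let ψ : B →+* K := MvPolynomial.eval₂Hom (constCoeff K σ) (fun _ => 0)
  have hψC : ∀ r, ψ (MvPolynomial.C r) = r.coeff 0 := fun r =>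
    MvPolynomial.eval₂Hom_C _ _ _
  have hprime : (RingHom.ker ψ).IsPrime := RingHom.ker_isPrime ψ
  have hn : (MvPolynomial.C (chi K σ.height) : B) ∈ RingHom.ker ψ := by
    rw [RingHom.mem_ker, hψC, coeff_chi_of_ne (Ne.symm hH)]
  by_cases hcase : ∃ s ∉ RingHom.ker ψ, ∃ n : ℕ,
      s * (MvPolynomial.C (chi K σ.height) : B) ^ n ∈ J
  · obtain ⟨s, hs, n, hsJ⟩ := hcase
    let W : Set V := {w | w ∈ interior (σ.cone : Set V) ∧ ∀ m ∈ F, 0 < m w}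
    let RL := Localization (monomialSubmonoid σ K)
    let u : F → RL := fun j => IsLocalization.mk' RL (chi K (b j))
      (⟨_, chi_mem_monomialSubmonoid (a j)⟩ : monomialSubmonoid σ K)
    have hu : ∀ j, algebraMap (PSeries K σ) RL (chi K (a j)) * u j
        = algebraMap (PSeries K σ) RL (chi K (b j)) := fun j =>
      IsLocalization.mk'_spec' RL _ _
    have hpos := isPositive_eval (K := K) (σ := σ) (W := W) (fun w hw => hw.1) u (fun j =>
      ⟨a j, chi K (b j), (hu j).symm, fun w hw m hm => by
        rw [HahnSeries.eq_of_mem_support_single hm, hab]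
        linarith [hw.2 j j.2]⟩) s
    have hJle : J ≤ (I.map (algebraMap (PSeries K σ) RL)).comap
        (MvPolynomial.eval₂Hom (algebraMap (PSeries K σ) RL) u) := by
      refine sup_le (Ideal.map_le_iff_le_comap.mpr fun r hr => ?_) (Ideal.span_le.mpr ?_)
      · rw [Ideal.mem_comap, Ideal.mem_comap, MvPolynomial.eval₂Hom_C]
        exact Ideal.mem_map_of_mem _ hr
      · rintro _ ⟨j, rfl⟩
        rw [SetLike.mem_coe, Ideal.mem_comap, map_sub, map_mul, MvPolynomial.eval₂Hom_C,
          MvPolynomial.eval₂Hom_C, MvPolynomial.eval₂Hom_X', hu, sub_self]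
        exact Ideal.zero_mem _
    have hmem := hJle hsJ
    rw [Ideal.mem_comap, map_mul, map_pow, MvPolynomial.eval₂Hom_C, ← map_pow, ← chi_nsmul] at hmem
    obtain ⟨f, hf, c, hc, hfc⟩ := exists_dominant_of_isPositive (W := W) ⟨w₁, hw₁, hFw₁⟩ hs hpos hmem
    exact ⟨f, hf, c, hc, fun w hw hFw => hfc w ⟨hw, hFw⟩⟩
  · push Not at hcase
    obtain ⟨P, L, hP, hJP, hhP, hLmul, hLnn, hLpos, hLsum⟩ :=
      exists_real_semivaluation (RingHom.ker ψ) J hn hcase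
    have hchi : ∀ m : Exps σ, (MvPolynomial.C (chi K m) : B) ∉ P := by
      intro m hm
      obtain ⟨n, hn⟩ := σ.exists_add_height ((dualLattice N).neg_mem m.2.1)
      have h1 : n • σ.height = m + ⟨_, hn⟩ := Subtype.ext (by simp)
      refine hhP (hP.mem_of_pow_mem n ?_)
      rw [← map_pow, ← chi_nsmul, h1, chi_add, map_mul]
      exact Ideal.mul_mem_right _ _ hm
    let l : Exps σ →+ ℝ := AddMonoidHom.mk' (fun m => L (MvPolynomial.C (chi K m))) fun x y => by
      rw [chi_add, map_mul, hLmul _ _ (hchi x) (hchi y)]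
    obtain ⟨w, hw⟩ := σ.exists_weight l
    have hwL : ∀ m : Exps σ, m.1 w = L (MvPolynomial.C (chi K m)) := hw
    have hwσ : w ∈ interior (σ.cone : Set V) := σ.mem_interior_of_exps_pos fun m hm => by
      rw [hwL]
      refine hLpos _ ?_ (hchi m)
      rw [RingHom.mem_ker, hψC, coeff_chi_of_ne (Ne.symm hm)]
    have hwF : ∀ m ∈ F, 0 < m w := by
      intro m hm
      let j : F := ⟨m, hm⟩
      -- The two-term relation is fitted to the ultrametric inequality through the sign of X_j and a
      -- dummy one-element index set.
      have hrel : (MvPolynomial.C (chi K (b j)) : B) +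
          ∑ _t ∈ {(0 : Exps σ)}, MvPolynomial.C (chi K (a j)) * (-MvPolynomial.X j) ∈ P := by
        have h1 : (MvPolynomial.C (chi K (b j)) : B) + ∑ _t ∈ {(0 : Exps σ)},
            MvPolynomial.C (chi K (a j)) * (-MvPolynomial.X j) = -(MvPolynomial.C (chi K (a j)) *
            MvPolynomial.X j - MvPolynomial.C (chi K (b j))) := by
          rw [Finset.sum_singleton]
          ring
        rw [h1]
        exact P.neg_mem (hJP (Ideal.mem_sup_right (Ideal.subset_span ⟨j, rfl⟩)))
      obtain ⟨-, -, ht, htL⟩ := hLsum (Exps σ) {0} (MvPolynomial.C (chi K (b j)))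
        (fun _ => MvPolynomial.C (chi K (a j)) * (-MvPolynomial.X j)) (hchi _) hrel
      have hX : (-MvPolynomial.X j : B) ∉ P := fun h => ht (P.mul_mem_left _ h)
      rw [hLmul _ _ (hchi _) hX, ← hwL, ← hwL, hab] at htL
      have := hLpos (-MvPolynomial.X j) (by
        rw [RingHom.mem_ker, map_neg, MvPolynomial.eval₂Hom_X', neg_zero]) hX
      change 0 < (j : Module.Dual ℝ V) w
      linarith
    obtain ⟨m₀, hm₀⟩ := hI w hwσ hwF
    obtain ⟨f, hf, hfm, hmin⟩ := exists_of_chi_mem_initialIdeal hm₀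
    -- The ultrametric inequality applied to f ∈ P needs a finite sum; it yields an exponent t ≠ m₀
    -- of f of weight at most that of m₀.
    obtain ⟨T, hT, q, hq⟩ := PSeries.exists_sum_chi_mul (f - chi K m₀)
    obtain ⟨t, ht, htP, htL⟩ := hLsum (Exps σ) T (MvPolynomial.C (chi K m₀))
      (fun t => MvPolynomial.C (chi K t) * MvPolynomial.C (q t)) (hchi m₀) (by
        have h1 : (MvPolynomial.C (chi K m₀) : B) +
            ∑ t ∈ T, MvPolynomial.C (chi K t) * MvPolynomial.C (q t) = MvPolynomial.C f := by
          simp_rw [← map_mul]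
          rw [← map_sum, ← hq, ← map_add, add_sub_cancel]
        rw [h1]
        exact hJP (Ideal.mem_sup_left (Ideal.mem_map_of_mem _ hf)))
    have hqP : (MvPolynomial.C (q t) : B) ∉ P := fun h => htP (P.mul_mem_left _ h)
    rw [hLmul _ _ (hchi t) hqP, ← hwL, ← hwL] at htL
    have h1 := hT t ht
    have htm : t ≠ m₀ := by
      rintro rfl
      rw [HahnSeries.mem_support, HahnSeries.coeff_sub, hfm, coeff_chi_self, sub_self] at h1
      exact h1 rfl
    have h2 : t ∈ f.support := by
      rwa [HahnSeries.mem_support, HahnSeries.coeff_sub, coeff_chi_of_ne htm, sub_zero] at h1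
    have h3 := hmin t h2 htm
    have h4 := hLnn _ hqP
    linarith

end DominantTerm

/-! ### Interior germs and the construction of the divisor. -/

section Germs

variable {V : Type*} [NormedAddCommGroup V] [NormedSpace ℝ V] {N : Submodule ℤ V}

variable {σ : WeightCone N} {K : Type*} [Field K]

theorem PSeries.exists_eq_chi_mul {f : PSeries K σ} {c : Exps σ} (h : ∀ m ∈ f.support, c ≤ m) :
    ∃ g, f = chi K c * g := by
  refine ⟨PSeries.ofCoeff fun x => f.coeff (c + x), ?_⟩
  ext m
  by_cases hm : c ≤ m
  · obtain ⟨x, rfl⟩ := Exps.le_iff_exists_add.mp hm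
    rw [coeff_chi_mul_add, PSeries.coeff_ofCoeff]
  · rw [coeff_chi_mul_of_not_le hm]
    exact not_not.mp fun h' => hm (h m h')

theorem InteriorGerm.chi_notMem (Y : InteriorGerm K σ) {P : Ideal (PSeries K σ)}
    (hP : P ∈ Y.ideal.minimalPrimes) (m : Exps σ) : chi K m ∉ P := fun hm =>
  Y.not_subset_boundary P hP fun _ hp => ⟨m, hp hm⟩

theorem InteriorGerm.mem_of_chi_mul_mem (Y : InteriorGerm K σ) {m : Exps σ} {f : PSeries K σ}
    (h : chi K m * f ∈ Y.ideal) : f ∈ Y.ideal := by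
  rw [← Y.reduced.radical, ← Ideal.sInf_minimalPrimes, Ideal.mem_sInf]
  intro P hP
  exact (hP.1.1.mem_or_mem (hP.1.2 h)).resolve_left (Y.chi_notMem hP m)

/-- The interior divisor defined by a series which generates a radical ideal without monomials in
its minimal primes. -/
def InteriorGerm.ofSeries (h : PSeries K σ) (hrad : (Ideal.span {h}).IsRadical)
    (hh : ∀ P ∈ (Ideal.span {h}).minimalPrimes, ∀ m : Exps σ, chi K m ∉ P) : InteriorGerm K σ where
  ideal := Ideal.span {h}
  reduced := hrad
  not_subset_boundary P hP hle := by
    obtain ⟨m, hm⟩ := hle (a := ⟨P, hP.1.1⟩) (PrimeSpectrum.mem_zeroLocus _ _ |>.mpr le_rfl)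
    exact hh P hP m hm

theorem InteriorGerm.trop_mono {D Y : InteriorGerm K σ} (h : D.Contains Y) : Y.trop ⊆ D.trop := by
  refine closure_mono ?_
  rintro _ ⟨w, hw, c, hc, rfl⟩
  exact ⟨w, ⟨hw.1, fun m hm => hw.2 m (Ideal.span_mono (Set.image_mono h) hm)⟩, c, hc, rfl⟩

theorem InteriorGerm.smul_mem_trop (Y : InteriorGerm K σ) {w : V} (hw : w ∈ Y.initialWeights)
    {c : ℝ} (hc : 0 ≤ c) : c • w ∈ Y.trop :=
  subset_closure ⟨w, hw, c, hc, rfl⟩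

variable [FiniteDimensional ℝ V]

/-- Dominance is known at interior weights only; at w₀, possibly on the boundary of σ, it survives
by continuity as a weak inequality. -/
theorem le_of_interior {a b : Module.Dual ℝ V} {O : Set V} (hO : IsOpen O)
    (h : ∀ w ∈ interior (σ.cone : Set V), w ∈ O → a w ≤ b w) {w₀ : V} (hw₀ : w₀ ∈ σ.cone)
    (hwO : w₀ ∈ O) : a w₀ ≤ b w₀ := by
  by_contra! hlt
  obtain ⟨v, ⟨hvO, hv⟩, hvi⟩ := mem_closure_iff.mp (σ.subset_closure_interior hw₀)
    (O ∩ {v | b v < a v}) (hO.inter (isOpen_lt (continuous_dual b) (continuous_dual a)))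
    ⟨hwO, hlt⟩
  exact absurd (h v hvi hvO) (not_le.mpr hv)

variable [DiscreteTopology N] [IsZLattice ℝ N]

theorem InteriorGerm.trop_subset (Y : InteriorGerm K σ) : Y.trop ⊆ σ.cone := by
  refine closure_minimal ?_ σ.isClosed
  rintro _ ⟨w, hw, c, hc, rfl⟩
  exact σ.smul_mem (interior_subset hw.1) hc

theorem InteriorGerm.notMem_trop (D : InteriorGerm K σ) {h : PSeries K σ} (hh : h ∈ D.ideal)
    {c : Exps σ} (hc : c ∈ h.support) {w₀ : V} (hw₀ : w₀ ≠ 0) {O : Set V} (hO : IsOpen O)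
    (hwO : w₀ ∈ O) (hdom : ∀ w ∈ interior (σ.cone : Set V), w ∈ O →
      ∀ m ∈ h.support, m ≠ c → c.1 w < m.1 w) : w₀ ∉ D.trop := by
  intro hmem
  obtain ⟨v, ⟨hvO, hv0⟩, w, hw, k, hk, rfl⟩ := mem_closure_iff.mp hmem (O ∩ {0}ᶜ)
    (hO.inter isOpen_compl_singleton) ⟨hwO, hw₀⟩
  have hk0 : 0 < k := lt_of_le_of_ne hk fun h => hv0 (by rw [← h, zero_smul]; rfl)
  refine hw.2 c (chi_mem_initialIdeal hh hc fun m hm hne => ?_)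
  have := hdom _ (σ.smul_mem_interior hw.1 hk0) hvO m hm hne
  rw [map_smul, map_smul] at this
  exact lt_of_mul_lt_mul_left this hk

/-- A lattice coordinate of exponents, mapped to K, gives θ. It is non-zero in any characteristic,
because coord i + k • height has value 1 + k * θ(height). The unit is 1 + χ^a with θ a ≠ 0. -/
theorem exists_unit_derivation_ne_zero {w₀ : V} (h0 : w₀ ≠ 0) :
    ∃ (D : Derivation K (PSeries K σ) (PSeries K σ)) (e : PSeries K σ), IsUnit e ∧ D e ≠ 0 := by
  obtain ⟨n, b, hbN, hb⟩ := exists_lattice_basis N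
  obtain ⟨i⟩ : Nonempty (Fin n) := by
    by_contra hemp
    rw [not_nonempty_iff] at hemp
    exact h0 (by rw [← b.sum_repr w₀, Finset.univ_eq_empty, Finset.sum_empty])
  choose z hz using fun m : Exps σ => m.2.1 (b i) (hbN i)
  have hzadd : ∀ x y, z (x + y) = z x + z y := fun x y => by
    have h1 : (x + y).1 (b i) = x.1 (b i) + y.1 (b i) := rfl
    rw [hz, hz, hz] at h1
    exact_mod_cast h1
  let θ : Exps σ →+ K := (Int.castAddHom K).comp (AddMonoidHom.mk' z hzadd)
  obtain ⟨a, ha⟩ : ∃ a, θ a ≠ 0 := by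
    by_contra! hcon
    obtain ⟨k, hk⟩ := σ.exists_add_height (hb i)
    have h1 : z ⟨_, hk⟩ = 1 + k * z σ.height := by
      have h2 := hz ⟨_, hk⟩
      simp only [LinearMap.add_apply, LinearMap.smul_apply, Module.Basis.coord_apply,
        Module.Basis.repr_self, Finsupp.single_eq_same, hz σ.height, nsmul_eq_mul] at h2
      exact_mod_cast h2.symm
    have h3 : θ ⟨_, hk⟩ = 1 + k * θ σ.height := by
      change ((z _ : ℤ) : K) = 1 + k * ((z _ : ℤ) : K)
      rw [h1]
      push_cast
      rfl
    rw [hcon, hcon, mul_zero, add_zero] at h3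
    exact zero_ne_one h3
  have ha0 : a ≠ 0 := fun h => ha (by rw [h, map_zero])
  refine ⟨toricDerivation θ, 1 + chi K a, PSeries.isUnit_of_coeff_zero_ne ?_, fun h => ?_⟩
  · rw [HahnSeries.coeff_add, coeff_chi_of_ne ha0.symm, ← chi_zero, coeff_chi_self, add_zero]
    exact one_ne_zero
  · have h1 := toricDerivation_coeff θ (1 + chi K a) a
    rw [h, HahnSeries.coeff_add, coeff_chi_self, ← chi_zero, coeff_chi_of_ne ha0, zero_add,
      mul_one] at h1
    exact ha h1.symm

theorem chi_height_mem {P : Ideal (PSeries K σ)} [P.IsPrime] {m : Exps σ} (hm : chi K m ∈ P) :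
    chi K σ.height ∈ P := by
  obtain ⟨n, hn⟩ := σ.exists_add_height ((dualLattice N).neg_mem m.2.1)
  have h1 : n • σ.height = m + ⟨_, hn⟩ := Subtype.ext (by simp)
  refine Ideal.IsPrime.mem_of_pow_mem ‹_› n ?_
  rw [← chi_nsmul, h1, chi_add]
  exact Ideal.mul_mem_right _ _ hm

/-- If the divisor attached to the ray through `w₀` is locally principal, an element of `I` with a
dominant term near `w₀` may be replaced by one which does not vanish on this divisor. -/
theorem exists_notMem_faceIdeal (Y : InteriorGerm K σ) {w₀ : V} (hw₀ : w₀ ∈ σ.cone) (h0 : w₀ ≠ 0)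
    (hloc : IsLocallyPrincipal (faceIdeal K hw₀)) {O : Set V} (hO : IsOpen O) (hwO : w₀ ∈ O)
    {f : PSeries K σ} (hf : f ∈ Y.ideal) {c : Exps σ} (hc : c ∈ f.support)
    (hdom : ∀ w ∈ interior (σ.cone : Set V), w ∈ O → ∀ m ∈ f.support, m ≠ c → c.1 w < m.1 w) :
    ∃ g ∈ Y.ideal, g ∉ faceIdeal K hw₀ ∧ ∃ d ∈ g.support,
      ∀ w ∈ interior (σ.cone : Set V), w ∈ O → ∀ m ∈ g.support, m ≠ d → d.1 w < m.1 w := by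
  have hprime := isPrime_faceIdeal (K := K) hw₀
  -- A vector u with more vanishing exponents gives a non-zero prime inside that of w₀; local
  -- principality forces equality, so w₀ spans a ray.
  obtain ⟨m₁, hm₁, hgens⟩ := σ.exists_facet_exponent hw₀ h0 fun u hu hu0 hle m hmu => by
    have hprime' := isPrime_faceIdeal (K := K) hu
    have h1 : faceIdeal K hu ≤ faceIdeal K hw₀ := fun x hx m hm =>
      lt_of_le_of_ne (m.2.2 _ hw₀) fun h => (mem_faceIdeal.mp hx m hm).ne' (hle m h.symm)
    have h2 : chi K σ.height ∈ faceIdeal K hu := chi_mem_faceIdeal.mpr (σ.height_pos hu hu0)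
    have h3 := hloc.eq_of_le h1 fun h => chi_ne_zero σ.height (by rwa [h] at h2)
    have h4 : chi K m ∉ faceIdeal K hu := by
      rw [chi_mem_faceIdeal, hmu]
      exact lt_irrefl _
    rw [h3, chi_mem_faceIdeal] at h4
    exact le_antisymm (not_lt.mp h4) (m.2.2 _ hw₀)
  -- L is chosen so that χ^c divides χ^{L m₁} f: off the ray m₁ is at least 1 on generators, and on
  -- the ray c ≤ m by dominance. The quotient has dominant exponent L • m₁, which vanishes at w₀.
  obtain ⟨L, hL⟩ := exists_nat_ge (∑ s ∈ σ.gens, c.1 s)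
  have hle : ∀ m ∈ f.support, c ≤ L • m₁ + m := by
    intro m hm
    refine Exps.le_of_gens fun s hs => ?_
    change c.1 s ≤ L • m₁.1 s + m.1 s
    rcases hgens s hs with ⟨k, hk, rfl⟩ | hpos
    · have h1 : c.1 w₀ ≤ m.1 w₀ := le_of_interior hO (fun w hw hwO => by
        by_cases hmc : m = c
        · rw [hmc]
        · exact (hdom w hw hwO m hm hmc).le) hw₀ hwO
      rw [map_smul, map_smul, map_smul, hm₁, smul_zero, smul_zero, zero_add]
      exact mul_le_mul_of_nonneg_left h1 hk
    · have h1 := one_le_of_dualLattice m₁.2.1 (σ.gens_mem_lattice hs) hpos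
      have h2 : c.1 s ≤ L := (Finset.single_le_sum
        (fun t ht => c.2.2 t (σ.gens_mem_cone ht)) hs).trans hL
      have h3 : (L : ℝ) ≤ L * m₁.1 s := le_mul_of_one_le_right (by positivity) h1
      have h4 := m.2.2 s (σ.gens_mem_cone hs)
      rw [nsmul_eq_mul]
      linarith
  obtain ⟨g, hg⟩ := PSeries.exists_eq_chi_mul (f := chi K (L • m₁) * f) (c := c) fun m hm => by
    obtain ⟨x, hx, rfl⟩ := mem_support_chi_mul hm
    exact hle x hx
  have hd : L • m₁ ∈ g.support := by
    rw [HahnSeries.mem_support, ← coeff_chi_mul_add c, ← hg, add_comm, coeff_chi_mul_add]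
    exact hc
  refine ⟨g, Y.mem_of_chi_mul_mem (m := c) ?_, fun hmem => ?_, L • m₁, hd, fun w hw hwO m hm hne => ?_⟩
  · rw [← hg]
    exact Y.ideal.mul_mem_left _ hf
  · have := mem_faceIdeal.mp hmem _ hd
    change 0 < L • m₁.1 w₀ at this
    rw [hm₁, smul_zero] at this
    exact lt_irrefl _ this
  · have h1 : c + m ∈ (chi K (L • m₁) * f).support := by
      rw [hg, HahnSeries.mem_support, coeff_chi_mul_add]
      exact hm
    obtain ⟨x, hx, hcx⟩ := mem_support_chi_mul h1
    have hxc : x ≠ c := by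
      rintro rfl
      exact hne (add_left_cancel (hcx.trans (add_comm _ _)))
    have h2 := hdom w hw hwO x hx hxc
    have h3 : c.1 w + m.1 w = (L • m₁).1 w + x.1 w := congrArg (fun y : Exps σ => y.1 w) hcx
    linarith

/-- A series of the ideal of `Y` may be perturbed by series of high order along `w₀` in order to
define an interior divisor containing `Y`. -/
theorem exists_divisor [Infinite K] (Y : InteriorGerm K σ) {w₀ : V} (hw₀ : w₀ ∈ σ.cone)
    (h0 : w₀ ≠ 0) {f : PSeries K σ} (hf : f ∈ Y.ideal) (hf0 : f ≠ 0)
    (hface : IsLocallyPrincipal (faceIdeal K hw₀) → f ∉ faceIdeal K hw₀) (δ : ℝ) :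
    ∃ D : InteriorGerm K σ, D.IsPrincipalEffectiveDivisor ∧ D.Contains Y ∧
      ∃ g : PSeries K σ, f + g ∈ D.ideal ∧ ∀ m ∈ g.support, δ ≤ m.1 w₀ := by
  classical
  have hH := σ.height_pos hw₀ h0
  let J : Ideal (PSeries K σ) := supportIdeal K {m | δ ≤ m.1 w₀} fun a ha b =>
    le_add_of_le_of_nonneg ha (b.2.2 w₀ hw₀)
  have hchiJ : ∀ t : Exps σ, 0 < t.1 w₀ → ∃ n : ℕ, chi K t ^ n ∈ J := by
    intro t ht
    obtain ⟨n, hn⟩ := exists_nat_ge (δ / t.1 w₀)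
    refine ⟨n, ?_⟩
    rw [← chi_nsmul]
    refine chi_mem_supportIdeal.mpr ?_
    change δ ≤ n • t.1 w₀
    rwa [nsmul_eq_mul, ← div_le_iff₀ ht]
  obtain ⟨G, hG⟩ := IsNoetherian.noetherian (Y.ideal ⊓ J)
  obtain ⟨D, e, he, hDe⟩ := exists_unit_derivation_ne_zero (K := K) (σ := σ) h0
  obtain ⟨g, hg, hfg, hbad, hE⟩ := exists_generic_add D he hDe hf0
    (finite_isLocallyPrincipal_mem (chi_ne_zero (K := K) σ.height)) G
  have hgJ : g ∈ Y.ideal ⊓ J := by rw [← hG]; exact hg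
  have hY0 : Y.ideal ≠ ⊥ := fun h => hf0 (by rwa [h] at hf)
  have hboundary : ∀ P : Ideal (PSeries K σ), P.IsPrime → IsLocallyPrincipal P → f + g ∈ P →
      ∀ m : Exps σ, chi K m ∉ P := by
    intro P hP hloc hmem m hm
    obtain ⟨hfP, hGP⟩ := hE P ⟨hP, hloc, chi_height_mem hm⟩ hmem
    have hle : Y.ideal ⊓ J ≤ P := by
      rw [← hG]
      exact Submodule.span_le.mpr hGP
    -- If I_Y ⊆ P then P is a minimal prime of I_Y, which contains no monomial. If J ⊆ P then P is
    -- the face prime of w₀, excluded by `hface`.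
    rcases hP.inf_le.mp hle with h | h
    · obtain ⟨Q, hQ, hQP⟩ := Ideal.exists_minimalPrimes_le h
      have := hQ.1.1
      have hQ0 : Q ≠ ⊥ := fun h => hY0 (le_bot_iff.mp (h ▸ hQ.1.2))
      rw [← hloc.eq_of_le hQP hQ0] at hm
      exact Y.chi_notMem hQ m hm
    · have hprime := isPrime_faceIdeal (K := K) hw₀
      have hle : faceIdeal K hw₀ ≤ P := by
        intro q hq
        obtain ⟨T, hT, k, hk⟩ := PSeries.exists_sum_chi_mul q
        rw [hk]
        refine P.sum_mem fun t ht => P.mul_mem_right _ ?_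
        obtain ⟨n, hn⟩ := hchiJ t (mem_faceIdeal.mp hq t (hT t ht))
        exact hP.mem_of_pow_mem n (h hn)
      have hne : faceIdeal K hw₀ ≠ ⊥ := fun h => chi_ne_zero (K := K) σ.height (by
        have : chi K σ.height ∈ faceIdeal K hw₀ := chi_mem_faceIdeal.mpr hH
        rwa [h] at this)
      have heq := hloc.eq_of_le hle hne
      exact hface (heq ▸ hloc) (heq ▸ hfP)
  have hnormal := PSeries.isCompletelyNormal (K := K) (σ := σ)
  have hrad : (Ideal.span {f + g}).IsRadical := by
    refine hnormal.isRadical_span_singleton hfg fun P hP hsq => ?_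
    have hPp := hP.1
    have hloc := hnormal.isLocallyPrincipal hfg hP
    have hu := hbad P hPp hloc hsq
    choose! u hu huP using hu
    obtain ⟨n, hn⟩ := hchiJ σ.height hH
    have hmon := hboundary P hPp hloc hsq.mem
    -- The power of χ^height moves I_Y into I_Y ⊓ J, and the product of the u x moves the generators
    -- of the latter into P².
    refine not_mul_le_sq Y.reduced hY0 hloc (v := (∏ x ∈ G, u x) * chi K σ.height ^ n)
      (fun hmem => ?_) fun x hx => ?_
    · rcases hPp.mem_or_mem hmem with h | h
      · obtain ⟨x, hx, hxP⟩ := hPp.prod_mem_iff.mp h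
        exact hu x hx hxP
      · exact hmon _ (hPp.mem_of_pow_mem n h)
    · have hle : ∀ y ∈ Y.ideal ⊓ J, (∏ x ∈ G, u x) * y ∈ P ^ 2 := by
        intro y hy
        rw [← hG] at hy
        induction hy using Submodule.span_induction with
        | mem y hy =>
          rw [← Finset.prod_erase_mul G u hy, mul_assoc]
          exact Ideal.mul_mem_left _ _ (huP y hy)
        | zero =>
          rw [mul_zero]
          exact zero_mem _
        | add y z _ _ hy hz =>
          rw [mul_add]
          exact add_mem hy hz
        | smul r y _ hy =>
          rw [smul_eq_mul, mul_left_comm]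
          exact Ideal.mul_mem_left _ _ hy
      rw [mul_assoc]
      exact hle _ ⟨Y.ideal.mul_mem_left _ hx, J.mul_mem_right _ hn⟩
  refine ⟨InteriorGerm.ofSeries (f + g) hrad fun P hP => ?_, ⟨f + g, ?_, rfl⟩, ?_, g, ?_, ?_⟩
  · exact hboundary P hP.1.1
      (hnormal.isLocallyPrincipal hfg (isColonPrime_of_mem_minimalPrimes hrad hP))
      ((Ideal.span_singleton_le_iff_mem _).mp hP.1.2)
  · exact mem_nonZeroDivisors_of_ne_zero hfg
  · exact (Ideal.span_singleton_le_iff_mem _).mpr (Y.ideal.add_mem hf hgJ.1)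
  · exact Ideal.mem_span_singleton_self _
  · exact hgJ.2

theorem exists_divisor_notMem_trop [Infinite K] (Y : InteriorGerm K σ) {w₀ : V} (hw₀ : w₀ ∈ σ.cone)
    (hwY : w₀ ∉ Y.trop) : ∃ D : InteriorGerm K σ, D.IsPrincipalEffectiveDivisor ∧ D.Contains Y ∧
      w₀ ∉ D.trop := by
  by_cases h0 : w₀ = 0
  -- If 0 ∉ Trop Y there are no initial weights. The dominant series is then a monomial times a
  -- unit, so I_Y = (1) and Y itself serves as D.
  · obtain ⟨w₁, hw₁⟩ := σ.interior_nonempty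
    obtain ⟨f, hf, c, hc, hdom⟩ := exists_dominant_term (I := Y.ideal) ∅ (by simp) hw₁ (by simp)
      fun w hw _ => by
        by_contra! hcon
        refine hwY ?_
        rw [h0, ← zero_smul ℝ w]
        exact Y.smul_mem_trop ⟨hw, hcon⟩ le_rfl
    obtain ⟨g, rfl⟩ := PSeries.exists_eq_chi_mul (f := f) (c := c) fun m hm w hw =>
      le_of_interior isOpen_univ (fun w hw _ => by
        by_cases hmc : m = c
        · rw [hmc]
        · exact (hdom w hw (by simp) m hm hmc).le) hw trivial
    have hg : IsUnit g := PSeries.isUnit_of_coeff_zero_ne (by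
      rw [← coeff_chi_mul_add c, add_zero]
      exact hc)
    have htop : Y.ideal = Ideal.span {1} := by
      rw [Ideal.span_singleton_one]
      exact Ideal.eq_top_of_isUnit_mem _ (Y.mem_of_chi_mul_mem hf) hg
    exact ⟨Y, ⟨1, one_mem _, htop⟩, le_rfl, hwY⟩
  · obtain ⟨F, hF, hFU⟩ := σ.exists_finset_cone_subset hw₀ h0 (U := Y.tropᶜ)
      isClosed_closure.isOpen_compl hwY
    let O : Set V := ⋂ m ∈ F, {w | 0 < m w}
    have hO : IsOpen O :=
      isOpen_biInter_finset fun m _ => isOpen_lt continuous_const (continuous_dual m)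
    have hmemO : ∀ w, w ∈ O ↔ ∀ m ∈ F, 0 < m w := fun w => Set.mem_iInter₂
    have hwO : w₀ ∈ O := (hmemO w₀).mpr fun m hm => (hF m hm).2
    obtain ⟨w₁, hw₁O, hw₁⟩ := mem_closure_iff.mp (σ.subset_closure_interior hw₀) O hO hwO
    obtain ⟨f₀, hf₀, c₀, hc₀, hdom₀⟩ := exists_dominant_term (I := Y.ideal) F
      (fun m hm => (hF m hm).1) hw₁ ((hmemO w₁).mp hw₁O) fun w hw hwF => by
        by_contra! hcon
        obtain ⟨k, hk, hkU⟩ := hFU w (interior_subset hw) hwF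
        exact hkU (Y.smul_mem_trop ⟨hw, hcon⟩ hk.le)
    obtain ⟨f, hf, hface, c, hc, hdom⟩ : ∃ f ∈ Y.ideal,
        (IsLocallyPrincipal (faceIdeal K hw₀) → f ∉ faceIdeal K hw₀) ∧ ∃ c ∈ f.support,
        ∀ w ∈ interior (σ.cone : Set V), w ∈ O → ∀ m ∈ f.support, m ≠ c → c.1 w < m.1 w := by
      have hdom₁ := fun w hw hw' => hdom₀ w hw ((hmemO w).mp hw')
      by_cases hloc : IsLocallyPrincipal (faceIdeal K hw₀)
      · obtain ⟨f, hf, hface, hdom⟩ :=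
          exists_notMem_faceIdeal Y hw₀ h0 hloc hO hwO hf₀ hc₀ hdom₁
        exact ⟨f, hf, fun _ => hface, hdom⟩
      · exact ⟨f₀, hf₀, fun h => absurd h hloc, c₀, hc₀, hdom₁⟩
    -- The order c(w₀) + 1 puts all terms of g above c at w₀. Since g has finitely many minimal
    -- exponents, this persists on a neighbourhood of w₀ in σ.
    obtain ⟨D, hD, hDY, g, hfg, hg⟩ := exists_divisor Y hw₀ h0 hf
      (HahnSeries.ne_zero_of_coeff_ne_zero hc) hface (c.1 w₀ + 1)
    obtain ⟨T, hT, hTle⟩ := Exps.exists_finset_le g.support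
    refine ⟨D, hD, hDY, D.notMem_trop hfg (c := c) ?_ h0
      (hO.inter (isOpen_biInter_finset (s := T) (f := fun t => {w | c.1 w < t.1 w}) fun t _ =>
        isOpen_lt (continuous_dual _) (continuous_dual _)))
      ⟨hwO, Set.mem_iInter₂.mpr fun t ht => ?_⟩ fun w hw hwO m hm hne => ?_⟩
    · have hgc : g.coeff c = 0 := by
        by_contra h
        have := hg c h
        linarith
      rw [HahnSeries.mem_support, HahnSeries.coeff_add, hgc, add_zero]
      exact hc
    · have := hg t (hT ht)
      change c.1 w₀ < t.1 w₀
      linarith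
    · by_cases hmf : m ∈ f.support
      · exact hdom w hw hwO.1 m hmf hne
      · have hmg : m ∈ g.support := fun h => hm (by
          rw [HahnSeries.coeff_add, not_not.mp hmf, h, add_zero])
        obtain ⟨t, ht, htm⟩ := hTle m hmg
        exact lt_of_lt_of_le (Set.mem_iInter₂.mp hwO.2 t ht) (htm w (interior_subset hw))

end Germs

end LocTrop

end

theorem mainTheorem8 {K : Type*} [Field K] [IsAlgClosed K]
    {V : Type*} [NormedAddCommGroup V] [NormedSpace ℝ V] [FiniteDimensional ℝ V]
    (N : Submodule ℤ V) [DiscreteTopology N] [IsZLattice ℝ N]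
    (σ : LocTrop.WeightCone N) (Y : LocTrop.InteriorGerm K σ) :
    Y.trop = {w : V | w ∈ σ.cone ∧ ∀ D : LocTrop.InteriorGerm K σ,
      D.IsPrincipalEffectiveDivisor → D.Contains Y → w ∈ D.trop} := by
  refine Set.Subset.antisymm
    (fun w hw => ⟨Y.trop_subset hw, fun D _ hDY => LocTrop.InteriorGerm.trop_mono hDY hw⟩) ?_
  rintro w ⟨hw, hD⟩
  by_contra hwY
  obtain ⟨D, hDp, hDY, hwD⟩ := LocTrop.exists_divisor_notMem_trop Y hw hwY
  exact hwD (hD D hDp hDY)
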